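/- Let $\Pi$ be a finite set of proposition symbols. A $\Pi$-model is a Kripke model $M=(W,R,V)$ with a set $W$ (possibly infinite), $R\subseteq W\times W$ and $V\colon W\to\mathcal P(\Pi)$, in which every node $w$ has only finitely many successors (nodes $v$ with $(w,v)\in R$). A node property over $\Pi$ is a class $P$ of pointed $\Pi$-models $(M,w)$, $w\in W$. - $P$ is definable in monadic second-order logic (MSO) if there is a formula $\varphi(x)$, with one free first-order variable $x$ and no free set variables, built from the atoms $p(x)$ ($p\in\Pi$), $R(x,y)$, $x=y$, $X(x)$ by Boolean connectives and by quantification over nodes and over sets of nodes, such that for every pointed $\Pi$-model, $M\models\varphi(w)$ if and only if $(M,w)\in P$. - A recurrent $\mathrm{GNN}[\mathbb R]$ over $(\Pi,d)$ is given by arbitrary functions $\pi\colon\mathcal P(\Pi)\to\mathbb R^d$, $\mathrm{AGG}$ from multisets over $\mathbb R^d$ to $\mathbb R^d$, and $\mathrm{COM}\colon\mathbb R^d\times\mathbb R^d\to\mathbb R^d$, together with a set $F\subseteq\mathbb R^d$. In a $\Pi$-model it computes $x_w^0=\pi(V(w))$ and $x_w^{t+1}=\mathrm{COM}\big(x_w^t,\mathrm{AGG}(\{\{x_v^t\mid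 (w,v)\in R\}\})\big)$, and it accepts $(M,w)$ if $x_w^t\in F$ for some $t\in\mathbb N$. It expresses $P$ if it accepts exactly the pointed $\Pi$-models in $P$. - Schemata of the graded modal substitution calculus (GMSC) over variables $X_1,\dots,X_n$ are given by $\varphi::=\top\mid p\mid X_i\mid\neg\varphi\mid\varphi\lor\varphi\mid\Diamond_{\ge k}\varphi$ with $p\in\Pi$, $k\in\mathbb N$, where $\Diamond_{\ge k}\varphi$ is true in $w$ if $\varphi$ is true in at least $k$ successors of $w$; schemata without variables are the formulae of graded modal logic (GML). A GMSC program consists of some $n\in\mathbb N$, GML-formulae $\varphi_1,\dots,\varphi_n$, schemata $\psi_1,\dots,\psi_n$ over $X_1,\dots,X_n$, and a set $\mathcal A\subseteq\{X_1,\dots,X_n\}$ of appointed predicates. In a $\Pi$-model, $X_i^0$ is true in $w$ if $\varphi_i$ is, and $X_i^{t+1}$ is true in $w$ if $\psi_i$ is true in $w$ when each variable $X_j$ is interpreted as $X_j^t$. The program accepts $(M,w)$ if $X_j^t$ is true in $w$ for some $t\in\mathbb N$ and some $X_j\in\mathcal A$. It defines $P$ if it accepts exactly the pointed $\Pi$-models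 in $P$. **Theorem.** Let $P$ be a node property over $\Pi$ that is definable in MSO. Then $P$ is expressible by a recurrent $\mathrm{GNN}[\mathbb R]$ over $(\Pi,d)$ for some $d$ if and only if $P$ is definable by a GMSC program over $\Pi$. -/

import Mathlib

universe u v

/-! Throughout, `Sig` is the (finite) set of proposition symbols. -/

/-- A Kripke model over `Sig` in which every node has only finitely many successors, so that the
successors of a node always carry a multiset (with multiplicities in `ℕ`) of feature vectors.
The set of nodes itself may be infinite. -/
structure KripkeModel (Sig : Type v) where
  /-- the nodes -/
  W : Type u
  /-- the accessibility relation; `R w x` means that `x` is a successor of `w` -/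
  R : W → W → Prop
  /-- the valuation: the set of proposition symbols true in a node -/
  V : W → Set Sig
  /-- every node has finitely many successors -/
  finite_succ : ∀ w, {x | R w x}.Finite

/-- A pointed Kripke model `(M, w)`. -/
structure PointedModel (Sig : Type v) where
  M : KripkeModel.{u, v} Sig
  w : M.W

/-- A node property over `Sig`: a class of pointed models. -/
abbrev NodeProperty (Sig : Type v) := Set (PointedModel.{u, v} Sig)

/-- The finite set of successors of a node. -/
noncomputable def KripkeModel.succ {Sig : Type v} (M : KripkeModel.{u, v} Sig) (w : M.W) :
    Finset M.W :=
  (M.finite_succ w).toFinset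

/-! ### Recurrent graph neural networks over the reals -/

/-- A recurrent graph neural network over `(Sig, d)` with real feature vectors. There is no
restriction on the initialization, aggregation and combination functions or on the set of
accepting feature vectors. -/
structure RealGNN (Sig : Type v) (d : ℕ) where
  init : Set Sig → (Fin d → ℝ)
  agg : Multiset (Fin d → ℝ) → (Fin d → ℝ)
  com : (Fin d → ℝ) → (Fin d → ℝ) → (Fin d → ℝ)
  acc : Set (Fin d → ℝ)

/-- The feature vector of each node in round `t`. -/
noncomputable def RealGNN.feature {Sig : Type v} {d : ℕ} (G : RealGNN Sig d)
    (M : KripkeModel.{u, v} Sig) : ℕ → M.W → (Fin d → ℝ)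
  | 0, w => G.init (M.V w)
  | t + 1, w => G.com (G.feature M t w) (G.agg ((M.succ w).val.map (G.feature M t)))

/-- A node is accepted if it visits an accepting feature vector in some round. -/
def RealGNN.Accepts {Sig : Type v} {d : ℕ} (G : RealGNN Sig d)
    (N : PointedModel.{u, v} Sig) : Prop :=
  ∃ t : ℕ, G.feature N.M t N.w ∈ G.acc

/-- `P` is expressible by a recurrent GNN over the reals. -/
def GNNExpressible {Sig : Type v} (P : NodeProperty.{u, v} Sig) : Prop :=
  ∃ (d : ℕ) (G : RealGNN Sig d), ∀ N : PointedModel.{u, v} Sig, G.Accepts N ↔ N ∈ P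

/-! ### Graded modal substitution calculus -/

/-- Schemata of GMSC with schema variables from `T`. -/
inductive Schema (Sig : Type v) (T : Type) : Type v
  | top : Schema Sig T
  | prop (p : Sig) : Schema Sig T
  | var (X : T) : Schema Sig T
  | neg (φ : Schema Sig T) : Schema Sig T
  | or (φ ψ : Schema Sig T) : Schema Sig T
  | dia (k : ℕ) (φ : Schema Sig T) : Schema Sig T

/-- Formulae of graded modal logic: schemata without schema variables. -/
abbrev GML (Sig : Type v) : Type v := Schema Sig Empty

/-- Truth of a schema in a node, where `val X` is the set of nodes in which `X` is true. -/
def Schema.Sat {Sig : Type v} {T : Type} (M : KripkeModel.{u, v} Sig) (val : T → Set M.W) :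
    Schema Sig T → M.W → Prop
  | .top, _ => True
  | .prop p, w => p ∈ M.V w
  | .var X, w => w ∈ val X
  | .neg φ, w => ¬ φ.Sat M val w
  | .or φ ψ, w => φ.Sat M val w ∨ ψ.Sat M val w
  | .dia k φ, w => (k : ℕ∞) ≤ {x | M.R w x ∧ φ.Sat M val x}.encard

/-- A program of GMSC: schema variables `X_i` (`i : Fin n`), base rules `X_i(0) :- base i`,
iteration rules `X_i :- step i`, and a set of appointed predicates. -/
structure GMSCProgram (Sig : Type v) where
  n : ℕ
  base : Fin n → GML Sig
  step : Fin n → Schema Sig (Fin n)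
  appointed : Set (Fin n)

/-- `L.extension M t i` is the set of nodes of `M` in which `X_i ^ t` is true. -/
def GMSCProgram.extension {Sig : Type v} (L : GMSCProgram Sig) (M : KripkeModel.{u, v} Sig) :
    ℕ → Fin L.n → Set M.W
  | 0, i => {w | (L.base i).Sat M (fun X => X.elim) w}
  | t + 1, i => {w | (L.step i).Sat M (L.extension M t) w}

/-- A program accepts if some appointed predicate is true in some round. -/
def GMSCProgram.Accepts {Sig : Type v} (L : GMSCProgram Sig)
    (N : PointedModel.{u, v} Sig) : Prop :=
  ∃ t : ℕ, ∃ j ∈ L.appointed, N.w ∈ L.extension N.M t j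

/-- `P` is definable by a program of GMSC. -/
def GMSCDefinable {Sig : Type v} (P : NodeProperty.{u, v} Sig) : Prop :=
  ∃ L : GMSCProgram Sig, ∀ N : PointedModel.{u, v} Sig, L.Accepts N ↔ N ∈ P

/-! ### Monadic second-order logic -/

/-- Formulae of MSO over Kripke models whose free variables are among `n` first-order and `m`
monadic second-order variables (de Bruijn indices: a quantifier binds index `0`). -/
inductive MSO (Sig : Type v) : ℕ → ℕ → Type v
  | prop {n m : ℕ} (p : Sig) (x : Fin n) : MSO Sig n m
  | rel {n m : ℕ} (x y : Fin n) : MSO Sig n m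
  | eq {n m : ℕ} (x y : Fin n) : MSO Sig n m
  | mem {n m : ℕ} (x : Fin n) (X : Fin m) : MSO Sig n m
  | neg {n m : ℕ} (φ : MSO Sig n m) : MSO Sig n m
  | and {n m : ℕ} (φ ψ : MSO Sig n m) : MSO Sig n m
  | ex {n m : ℕ} (φ : MSO Sig (n + 1) m) : MSO Sig n m
  | exSet {n m : ℕ} (φ : MSO Sig n (m + 1)) : MSO Sig n m

/-- Truth of an MSO formula under an assignment `e` of the first-order and `E` of the
second-order variables. -/
def MSO.Sat {Sig : Type v} (M : KripkeModel.{u, v} Sig) : {n m : ℕ} → MSO Sig n m →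
    (Fin n → M.W) → (Fin m → Set M.W) → Prop
  | _, _, .prop p x, e, _ => p ∈ M.V (e x)
  | _, _, .rel x y, e, _ => M.R (e x) (e y)
  | _, _, .eq x y, e, _ => e x = e y
  | _, _, .mem x X, e, E => e x ∈ E X
  | _, _, .neg φ, e, E => ¬ φ.Sat M e E
  | _, _, .and φ ψ, e, E => φ.Sat M e E ∧ ψ.Sat M e E
  | _, _, .ex φ, e, E => ∃ a : M.W, φ.Sat M (Fin.cons a e) E
  | _, _, .exSet φ, e, E => ∃ A : Set M.W, φ.Sat M e (Fin.cons A E)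

/-- `P` is definable by an MSO formula `φ(x)` with one free first-order variable and no free
second-order variables. -/
def MSODefinable {Sig : Type v} (P : NodeProperty.{u, v} Sig) : Prop :=
  ∃ φ : MSO Sig 1 0, ∀ N : PointedModel.{u, v} Sig,
    φ.Sat N.M (fun _ => N.w) (fun X => X.elim0) ↔ N ∈ P

/-! ### Multisets up to a threshold -/

/-! Both formalisms see a node only through finite parts of its unravelling; the unravelling to
depth t, up to isomorphism, is the `code` of depth t. The state of a GNN in round t is a function of
this code, and one particular GNN (`codeGNN`) computes the codes exactly. Truth in a given round of
a GMSC program depends on the code of some finite depth, so an accepting set of codes turns the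
program into a GNN.

For the converse, a program has only finitely many states, and MSO supplies the finiteness. A
GNN-expressible `P` is invariant under unravelling, and whether a tree lies in `P` depends only on
its MSO type of some fixed rank, of which there are finitely many. A node cannot know this type
after finitely many rounds, but it can track the set of types still possible: those of all
unravellings sharing its code of depth t. By the composition theorem `msoType_unravel_eq`, the type
of a tree is fixed by its root label and the types of the child subtrees, counted up to a threshold.
Completions below different children can be chosen independently (`join`), so the possible types in
the next round are fixed by the label and by the successors' sets of possible types, counted up to a
larger threshold (`possibleTypes_succ_eq`). Graded modalities can carry out this update. The program
accepts once every possible type forces membership in `P`; as the GNN decides after a finite depth,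
this happens for every member of `P`.

The combinatorial core of both threshold arguments is `AgreeUpTo.exists_pairs`. -/

namespace Multiset

open scoped Classical in
/-- Two multisets agree up to threshold `K` if all multiplicities, truncated at `K`, agree. -/
def AgreeUpTo {α : Type*} (K : ℕ) (s t : Multiset α) : Prop :=
  ∀ a, min K (s.count a) = min K (t.count a)

namespace AgreeUpTo

variable {α β : Type*} {K L : ℕ} {s t r : Multiset α}

theorem refl (K : ℕ) (s : Multiset α) : AgreeUpTo K s s := fun _ => rfl

theorem symm (h : AgreeUpTo K s t) : AgreeUpTo K t s := fun a => (h a).symm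

theorem trans (h : AgreeUpTo K s t) (h' : AgreeUpTo K t r) : AgreeUpTo K s r :=
  fun a => (h a).trans (h' a)

theorem le_iff_le [DecidableEq α] (h : AgreeUpTo K s t) (hr : ∀ a, r.count a ≤ K) :
    r ≤ s ↔ r ≤ t := by
  simp only [le_iff_count]
  refine forall_congr' fun a => ?_
  have h2 := hr a
  have h4 : min K (count a s) = min K (count a t) := by convert h a
  omega

theorem mem_iff (h : AgreeUpTo K s t) (hK : 0 < K) (a : α) : a ∈ s ↔ a ∈ t := by
  classical
  have h1 := h a
  rw [← one_le_count_iff_mem, ← one_le_count_iff_mem]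
  have h4 : min K (count a s) = min K (count a t) := by convert h1
  omega

theorem cons_of_le_count [DecidableEq α] {a : α} (h : K ≤ s.count a) :
    AgreeUpTo K (a ::ₘ s) s := by
  intro b
  have : min K ((a ::ₘ s).count b) = min K (s.count b) := by
    rw [count_cons]
    split_ifs with hb
    · subst hb; omega
    · simp
  convert this

theorem map (h : AgreeUpTo K s t) (f : α → β) : AgreeUpTo K (s.map f) (t.map f) := by
  classical
  intro b
  have key : ∀ {s t : Multiset α}, AgreeUpTo K s t →
      min K (count b (s.map f)) ≤ count b (t.map f) := by
    intro s t h
    rw [count_map, count_map]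
    -- Either one element of the fibre over `b` has multiplicity at least `K` in `s`, hence in `t`,
    -- and alone saturates the count; or truncation at `K` is faithful on the whole fibre.
    by_cases hbig : ∃ a, f a = b ∧ K ≤ s.count a
    · obtain ⟨a, ha, hK⟩ := hbig
      have h1 : min K (count a s) = min K (count a t) := by convert h a
      have h2 : count a (t.filter fun x => b = f x) = count a t := by
        rw [count_filter, if_pos ha.symm]
      have := count_le_card a (t.filter fun x => b = f x)
      omega
    · push Not at hbig
      refine (min_le_right _ _).trans (card_le_card ?_)
      rw [le_iff_count]
      intro a
      rw [count_filter, count_filter]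
      split_ifs with hb
      · have h1 : min K (count a s) = min K (count a t) := by convert h a
        have := hbig a hb.symm
        omega
      · exact le_rfl
  have h1 := key h
  have h2 := key h.symm
  have : min K (count b (s.map f)) = min K (count b (t.map f)) := by omega
  convert this

end AgreeUpTo

variable {C D : Type*} [Finite C] {K : ℕ}

/-- Pigeonhole over the `Nat.card C` possible labels of `d`. -/
theorem exists_lt_count_of_lt_count_map_snd [DecidableEq C] [DecidableEq D] (p : Multiset (C × D))
    (d : D) (h : K * Nat.card C < (p.map Prod.snd).count d) : ∃ c, K < p.count (c, d) := by
  classical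
  have := Fintype.ofFinite C
  by_contra! hc
  rw [count_map] at h
  have h1 : card (p.filter fun x => d = x.2) =
      ∑ c : C, count c ((p.filter fun x => d = x.2).map Prod.fst) := by
    rw [sum_count_eq_card (fun _ _ => Finset.mem_univ _), card_map]
  have h2 : ∀ c : C, count c ((p.filter fun x => d = x.2).map Prod.fst) ≤ K := by
    intro c
    refine le_trans (le_of_eq ?_) (hc c)
    rw [count_map, filter_filter, ← countP_eq_card_filter, count]
    refine countP_congr rfl fun x _ => ?_
    rcases x with ⟨x, y⟩
    simp [Prod.ext_iff]
  have h3 := Finset.sum_le_sum (fun c (_ : c ∈ Finset.univ) => h2 c)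
  rw [← h1] at h3
  simp only [Finset.sum_const, smul_eq_mul, Finset.card_univ, ← Nat.card_eq_fintype_card] at h3
  rw [mul_comm] at h3
  omega

/-- A labelling of the elements of a multiset by labels from a finite set can be transferred to
every multiset that agrees with it up to a sufficiently large threshold. -/
theorem AgreeUpTo.exists_pairs {p : Multiset (C × D)} {s : Multiset D}
    (h : AgreeUpTo (K * Nat.card C + 1) (p.map Prod.snd) s) :
    ∃ q : Multiset (C × D), q.map Prod.snd = s ∧ AgreeUpTo K q p := by
  classical
  -- Each missing copy of `d` receives a label whose pair with `d` already occurs more than `K`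
  -- times, so no truncated multiplicity changes.
  have grow : ∀ (r : Multiset D) (p : Multiset (C × D)),
      (∀ d ∈ r, K * Nat.card C < (p.map Prod.snd).count d) →
      ∃ q : Multiset (C × D), q.map Prod.snd = p.map Prod.snd + r ∧ AgreeUpTo K q p := by
    intro r
    induction r using Multiset.induction_on with
    | empty => exact fun p _ => ⟨p, by simp, .refl _ _⟩
    | cons d r ih =>
      intro p hp
      obtain ⟨c, hc⟩ := exists_lt_count_of_lt_count_map_snd p d (hp d (mem_cons_self _ _))
      obtain ⟨q, hq, hqp⟩ := ih ((c, d) ::ₘ p) fun d' hd' => by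
        rw [map_cons]
        exact (hp d' (mem_cons_of_mem hd')).trans_le (count_le_count_cons _ _ _)
      exact ⟨q, by rw [hq]; simp, hqp.trans (.cons_of_le_count hc.le)⟩
  -- Dually, a surplus copy of `d` is removed from a pair occurring more than `K` times, which
  -- leaves at least `K`. Multiplicities can differ only where both exceed `K * Nat.card C`, so
  -- pigeonhole applies in either case.
  have shrink : ∀ (r t : Multiset D) (p : Multiset (C × D)),
      p.map Prod.snd = t + r → (∀ d ∈ r, K * Nat.card C < t.count d) →
      ∃ q : Multiset (C × D), q.map Prod.snd = t ∧ AgreeUpTo K q p := by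
    intro r
    induction r using Multiset.induction_on with
    | empty => exact fun t p hp _ => ⟨p, by simpa using hp, .refl _ _⟩
    | cons d r ih =>
      intro t p hp ht
      obtain ⟨c, hc⟩ := exists_lt_count_of_lt_count_map_snd (K := K) p d (by
        rw [hp, count_add]
        have := ht d (mem_cons_self _ _)
        omega)
      have hmem : (c, d) ∈ p := count_pos.1 (by omega)
      have hpe := cons_erase hmem
      obtain ⟨q, hq, hqp⟩ := ih t (p.erase (c, d)) (by
        rw [← hpe, map_cons, add_cons] at hp
        exact (cons_inj_right d).1 hp) fun d' hd' => ht d' (mem_cons_of_mem hd')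
      refine ⟨q, hq, hqp.trans ?_⟩
      conv_rhs => rw [← hpe]
      refine (AgreeUpTo.cons_of_le_count ?_).symm
      rw [count_erase_self]
      omega
  have h' : ∀ d, min (K * Nat.card C + 1) (count d (p.map Prod.snd)) =
      min (K * Nat.card C + 1) (count d s) := fun d => by convert h d
  obtain ⟨q, hq, hqp⟩ := grow (s - p.map Prod.snd) p fun d hd => by
    have h1 := h' d
    have h2 := count_pos.2 hd
    rw [count_sub] at h2
    omega
  obtain ⟨q', hq', hqq⟩ := shrink (p.map Prod.snd - s) s q
    (by
      rw [hq]
      ext d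
      simp only [count_add, count_sub]
      omega)
    fun d hd => by
      have h1 := h' d
      have h2 := count_pos.2 hd
      rw [count_sub] at h2
      omega
  exact ⟨q', hq', hqq.trans hqp⟩

/-- Turns a labelling of a multiset back into a labelling of the indices, so that counting arguments
yield a choice for each successor. -/
theorem exists_eq_map_pair_of_map_snd_eq {C D ι : Type*} [Nonempty C] (f : ι → D) (s : Finset ι) :
    ∀ p : Multiset (C × D), p.map Prod.snd = s.val.map f →
      ∃ g : ι → C, p = s.val.map fun i => (g i, f i) := by
  classical
  induction s using Finset.induction_on with
  | empty =>
    intro p hp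
    exact ⟨fun _ => Classical.arbitrary C, by simpa using hp⟩
  | insert a s ha ih =>
    intro p hp
    rw [Finset.insert_val_of_notMem ha, map_cons] at hp
    obtain ⟨x, hx, hxa⟩ := mem_map.1 (hp ▸ mem_cons_self (f a) _ : f a ∈ p.map Prod.snd)
    obtain ⟨q, rfl⟩ := exists_cons_of_mem hx
    rw [map_cons, hxa] at hp
    obtain ⟨g, rfl⟩ := ih q ((cons_inj_right _).1 hp)
    refine ⟨Function.update g a x.1, ?_⟩
    rw [Finset.insert_val_of_notMem ha, map_cons, Function.update_self, ← hxa]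
    congr 1
    refine map_congr rfl fun i hi => ?_
    rw [Function.update_of_ne]
    rintro rfl
    exact ha hi

end Multiset

/-! ### Codes of the finite-depth unravellings -/

theorem KripkeModel.mem_succ {Sig : Type v} (M : KripkeModel.{u, v} Sig) {w x : M.W} :
    x ∈ M.succ w ↔ M.R w x := by
  simp [KripkeModel.succ]

theorem KripkeModel.mem_succ_val {Sig : Type v} (M : KripkeModel.{u, v} Sig) {w x : M.W} :
    x ∈ (M.succ w).val ↔ M.R w x :=
  M.mem_succ

theorem KripkeModel.encard_setOf_succ (M : KripkeModel.{u, v} Sig) (w : M.W) (Q : M.W → Prop)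
    [DecidablePred Q] :
    {x | M.R w x ∧ Q x}.encard = ((M.succ w).val.countP Q : ℕ∞) := by
  have : {x | M.R w x ∧ Q x} = ((M.succ w).filter Q : Set M.W) := by
    ext x
    simp [KripkeModel.mem_succ]
  rw [this, Set.encard_coe_eq_coe_finsetCard, Multiset.countP_eq_card_filter]
  rfl

section Code

variable {Sig : Type v} [Finite Sig]

/-- An injective numbering of the sets of proposition symbols. -/
noncomputable def labelCode (Sig : Type v) [Finite Sig] : Set Sig → ℕ :=
  fun S => Finite.equivFin (Set Sig) S

theorem labelCode_injective : Function.Injective (labelCode Sig) :=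
  fun _ _ h => (Finite.equivFin (Set Sig)).injective (Fin.ext h)

/-- The isomorphism type of the unravelling of a pointed model up to depth `t`, coded as a
natural number. -/
noncomputable def KripkeModel.code (M : KripkeModel.{u, v} Sig) : ℕ → M.W → ℕ
  | 0, w => Nat.pair (labelCode Sig (M.V w)) 0
  | t + 1, w => Nat.pair (labelCode Sig (M.V w)) (Encodable.encode ((M.succ w).val.map (M.code t)))

theorem KripkeModel.code_succ_eq_iff {M M' : KripkeModel.{u, v} Sig} {t : ℕ} {w : M.W} {w' : M'.W} :
    M.code (t + 1) w = M'.code (t + 1) w' ↔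
      M.V w = M'.V w' ∧ (M.succ w).val.map (M.code t) = (M'.succ w').val.map (M'.code t) := by
  simp [KripkeModel.code, Nat.pair_eq_pair, labelCode_injective.eq_iff]

theorem KripkeModel.code_zero_eq_iff {M M' : KripkeModel.{u, v} Sig} {w : M.W} {w' : M'.W} :
    M.code 0 w = M'.code 0 w' ↔ M.V w = M'.V w' := by
  simp [KripkeModel.code, Nat.pair_eq_pair, labelCode_injective.eq_iff]

/-- The multiset coded by a natural number. -/
def multisetOfCode (c : ℕ) : Multiset ℕ := (Encodable.decode c).getD 0

@[simp] theorem multisetOfCode_encode (s : Multiset ℕ) :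
    multisetOfCode (Encodable.encode s) = s := by
  simp [multisetOfCode]

/-- Truncation of a tree by one level. The function `h` is the same for all models. -/
theorem exists_code_eq_of_code_succ (Sig : Type v) [Finite Sig] (t : ℕ) :
    ∃ h : ℕ → ℕ, ∀ (M : KripkeModel.{u, v} Sig) (w : M.W), M.code t w = h (M.code (t + 1) w) := by
  induction t with
  | zero => exact ⟨fun c => Nat.pair c.unpair.1 0, fun M w => by simp [KripkeModel.code]⟩
  | succ t ih =>
    obtain ⟨h, hh⟩ := ih
    refine ⟨fun c => Nat.pair c.unpair.1 (Encodable.encode ((multisetOfCode c.unpair.2).map h)),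
      fun M w => ?_⟩
    have hM : h ∘ M.code (t + 1) = M.code t := funext fun v => (hh M v).symm
    rw [KripkeModel.code, KripkeModel.code]
    simp only [Nat.unpair_pair, multisetOfCode_encode, Multiset.map_map, hM]

/-- A round looks one level deeper: truncating the code recovers the node's own previous feature,
and the multiset inside the code recovers those of its successors. -/
theorem RealGNN.exists_feature_eq {d : ℕ} (G : RealGNN Sig d) (t : ℕ) :
    ∃ h : ℕ → (Fin d → ℝ), ∀ (M : KripkeModel.{u, v} Sig) (w : M.W),
      G.feature M t w = h (M.code t w) := by
  induction t with
  | zero =>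
    refine ⟨fun c => G.init (Function.invFun (labelCode Sig) c.unpair.1), fun M w => ?_⟩
    simp [KripkeModel.code, RealGNN.feature, Function.leftInverse_invFun labelCode_injective _]
  | succ t ih =>
    obtain ⟨h, hh⟩ := ih
    obtain ⟨k, hk⟩ := exists_code_eq_of_code_succ.{u, v} Sig t
    refine ⟨fun c => G.com (h (k c)) (G.agg ((multisetOfCode c.unpair.2).map h)), fun M w => ?_⟩
    have hM : h ∘ M.code t = G.feature M t := funext fun v => (hh M v).symm
    beta_reduce
    rw [RealGNN.feature, ← hk, ← hh, KripkeModel.code, Nat.unpair_pair, multisetOfCode_encode,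
      Multiset.map_map, hM]

/-! ### GMSC-definable properties are expressible by recurrent GNNs -/

/-- A property of nodes is determined by the code of depth `D`. -/
def DeterminedAt (D : ℕ) (Q : ∀ M : KripkeModel.{u, v} Sig, M.W → Prop) : Prop :=
  ∃ C : ℕ → Prop, ∀ M w, Q M w ↔ C (M.code D w)

theorem DeterminedAt.succ {D : ℕ} {Q : ∀ M : KripkeModel.{u, v} Sig, M.W → Prop}
    (h : DeterminedAt D Q) : DeterminedAt (D + 1) Q := by
  obtain ⟨C, hC⟩ := h
  obtain ⟨k, hk⟩ := exists_code_eq_of_code_succ.{u, v} Sig D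
  exact ⟨fun c => C (k c), fun M w => by rw [hC, hk]⟩

theorem DeterminedAt.mono {D D' : ℕ} (hD : D ≤ D') {Q : ∀ M : KripkeModel.{u, v} Sig, M.W → Prop}
    (h : DeterminedAt D Q) : DeterminedAt D' Q := by
  induction hD with
  | refl => exact h
  | step _ ih => exact ih.succ

/-- Each nested diamond costs one more level of depth. -/
theorem Schema.exists_determinedAt {T : Type} (φ : Schema Sig T) {D : ℕ}
    {val : ∀ M : KripkeModel.{u, v} Sig, T → Set M.W}
    (hval : ∀ X, DeterminedAt D fun M w => w ∈ val M X) :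
    ∃ D', DeterminedAt D' fun M w => φ.Sat M (val M) w := by
  induction φ with
  | top => exact ⟨0, fun _ => True, fun M w => by simp [Schema.Sat]⟩
  | prop p =>
    refine ⟨0, fun c => p ∈ Function.invFun (labelCode Sig) c.unpair.1, fun M w => ?_⟩
    simp [KripkeModel.code, Schema.Sat, Function.leftInverse_invFun labelCode_injective _]
  | var X => exact ⟨D, hval X⟩
  | neg φ ih =>
    obtain ⟨E, C, hC⟩ := ih
    exact ⟨E, fun c => ¬ C c, fun M w => not_congr (hC M w)⟩
  | or φ ψ ihφ ihψ =>
    obtain ⟨E, hE⟩ := ihφ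
    obtain ⟨E', hE'⟩ := ihψ
    obtain ⟨C, hC⟩ := hE.mono (le_max_left E E')
    obtain ⟨C', hC'⟩ := hE'.mono (le_max_right E E')
    exact ⟨max E E', fun c => C c ∨ C' c, fun M w => or_congr (hC M w) (hC' M w)⟩
  | dia k φ ih =>
    classical
    obtain ⟨E, C, hC⟩ := ih
    refine ⟨E + 1, fun c => k ≤ (multisetOfCode c.unpair.2).countP C, fun M w => ?_⟩
    simp only [Schema.Sat, KripkeModel.code, Nat.unpair_pair, multisetOfCode_encode]
    rw [KripkeModel.encard_setOf_succ, Nat.cast_le, Multiset.countP_map,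
      ← Multiset.countP_eq_card_filter]
    simp only [hC]

theorem GMSCProgram.exists_determinedAt (L : GMSCProgram Sig) (t : ℕ) :
    ∃ D, ∀ i, DeterminedAt D fun (M : KripkeModel.{u, v} Sig) w => w ∈ L.extension M t i := by
  have key : ∀ Q : Fin L.n → ∀ M : KripkeModel.{u, v} Sig, M.W → Prop,
      (∀ i, ∃ D, DeterminedAt D (Q i)) → ∃ D, ∀ i, DeterminedAt D (Q i) := by
    intro Q hQ
    choose D hD using hQ
    exact ⟨Finset.univ.sup D, fun i => (hD i).mono (Finset.le_sup (Finset.mem_univ i))⟩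
  induction t with
  | zero =>
    exact key _ fun i => Schema.exists_determinedAt (D := 0) (L.base i) fun X => X.elim
  | succ t ih =>
    obtain ⟨D, hD⟩ := ih
    exact key _ fun i => Schema.exists_determinedAt (L.step i) hD

/-- The recurrent GNN that computes the codes of all depths, with the round as second feature. -/
noncomputable def codeGNN (P : NodeProperty.{u, v} Sig) : RealGNN Sig 2 where
  init S := ![(Nat.pair (labelCode Sig S) 0 : ℕ), 0]
  agg s := ![(Encodable.encode (s.map fun x => ⌊x 0⌋₊) : ℕ), 0]
  com x y := ![(Nat.pair (Nat.unpair ⌊x 0⌋₊).1 ⌊y 0⌋₊ : ℕ), x 1 + 1]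
  acc := {x | ∃ t c : ℕ, x = ![(c : ℝ), (t : ℝ)] ∧
    ∀ N : PointedModel.{u, v} Sig, N.M.code t N.w = c → N ∈ P}

theorem codeGNN_feature (P : NodeProperty.{u, v} Sig) (M : KripkeModel.{u, v} Sig) (t : ℕ)
    (w : M.W) : (codeGNN P).feature M t w = ![(M.code t w : ℝ), (t : ℝ)] := by
  induction t generalizing w with
  | zero => simp [RealGNN.feature, KripkeModel.code, codeGNN]
  | succ t ih =>
    have : (codeGNN P).feature M t = fun w => ![(M.code t w : ℝ), (t : ℝ)] := funext ih
    rw [RealGNN.feature, this]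
    have hl : (Nat.unpair (M.code t w)).1 = labelCode Sig (M.V w) := by
      cases t <;> simp [KripkeModel.code]
    simp [codeGNN, hl, KripkeModel.code, Function.comp_def]

/-- If the program accepts in round t, all models with the same code of some depth `D` are accepted
as well, so the network accepts in round `D`, which may differ from t. Soundness is built into the
accepting set; the second feature identifies the depth, which a code alone need not reveal. -/
theorem GMSCDefinable.gnnExpressible {P : NodeProperty.{u, v} Sig} (h : GMSCDefinable P) :
    GNNExpressible P := by
  obtain ⟨L, hL⟩ := h
  refine ⟨2, codeGNN P, fun N => ⟨?_, fun hN => ?_⟩⟩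
  · rintro ⟨t, t', c, heq, hc⟩
    rw [codeGNN_feature] at heq
    have h0 := congrFun heq 0
    have h1 := congrFun heq 1
    simp only [Matrix.cons_val_zero, Matrix.cons_val_one, Nat.cast_inj] at h0 h1
    subst h1
    exact hc N h0
  · obtain ⟨t, j, hj, ht⟩ := (hL N).2 hN
    obtain ⟨D, hD⟩ := GMSCProgram.exists_determinedAt.{u, v} L t
    obtain ⟨C, hC⟩ := hD j
    refine ⟨D, D, N.M.code D N.w, codeGNN_feature _ _ _ _, fun N' hN' => ?_⟩
    exact (hL N').1 ⟨t, j, hj, (hC _ _).2 (hN' ▸ (hC _ _).1 ht)⟩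

end Code

/-! ### Unravellings -/

section Unravelling

variable {Sig : Type v}

/-- Finite directed paths of a model starting in a given node. -/
inductive KripkeModel.Path (M : KripkeModel.{u, v} Sig) : M.W → Type u
  | nil (w : M.W) : M.Path w
  | cons {w : M.W} (x : M.W) (h : M.R w x) (p : M.Path x) : M.Path w

namespace KripkeModel

variable {M : KripkeModel.{u, v} Sig}

namespace Path

/-- The last node of a path. -/
def last : {w : M.W} → M.Path w → M.W
  | w, nil _ => w
  | _, cons _ _ p => p.last

/-- Extension of a path by one step at its end. -/
inductive Step : {w : M.W} → M.Path w → M.Path w → Prop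
  | nil {w x : M.W} (h : M.R w x) : Step (Path.nil w) (Path.cons x h (Path.nil x))
  | cons {w x : M.W} (h : M.R w x) {p q : M.Path x} : Step p q →
      Step (Path.cons x h p) (Path.cons x h q)

/-- Extension of a path by a node at its end. -/
def snoc : {w : M.W} → (p : M.Path w) → (x : M.W) → M.R p.last x → M.Path w
  | _, nil _, x, h => cons x h (nil x)
  | _, cons y hy p, x, h => cons y hy (p.snoc x h)

theorem last_snoc {w : M.W} (p : M.Path w) {x : M.W} (h : M.R p.last x) :
    (p.snoc x h).last = x := by
  induction p with
  | nil w => rfl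
  | cons y hy p ih => exact ih h

theorem step_snoc {w : M.W} (p : M.Path w) {x : M.W} (h : M.R p.last x) : Step p (p.snoc x h) := by
  induction p with
  | nil w => exact .nil h
  | cons y hy p ih => exact .cons hy (ih h)

theorem step_iff {w : M.W} {p q : M.Path w} : Step p q ↔ ∃ x h, q = p.snoc x h := by
  constructor
  · intro h
    induction h with
    | nil h => exact ⟨_, h, rfl⟩
    | cons h _ ih =>
      obtain ⟨x, hx, rfl⟩ := ih
      exact ⟨x, hx, rfl⟩
  · rintro ⟨x, h, rfl⟩
    exact step_snoc p h

theorem setOf_step {w : M.W} (p : M.Path w) :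
    {q | Step p q} = Set.range fun x : {x // M.R p.last x} => p.snoc x.1 x.2 := by
  ext q
  simp only [Set.mem_ofPred_eq, step_iff, Set.mem_range, Subtype.exists]
  exact exists_congr fun x => exists_congr fun h => eq_comm

end Path

/-- The tree unravelling of a model from a node. -/
@[reducible] def unravel (M : KripkeModel.{u, v} Sig) (w : M.W) : KripkeModel.{u, v} Sig where
  W := M.Path w
  R := Path.Step
  V p := M.V p.last
  finite_succ p := by
    rw [Path.setOf_step]
    have : Finite {x // M.R p.last x} := M.finite_succ p.last
    exact Set.finite_range _

/-- A tree successor of `p` is `p` extended by one step, so `last` is a bijection onto the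
successors of `p.last`. Multiplicities survive, and with them all codes. -/
theorem map_last_succ_unravel (w : M.W) (p : M.Path w) :
    ((M.unravel w).succ p).val.map Path.last = (M.succ p.last).val := by
  classical
  have hinj : Set.InjOn Path.last ((M.unravel w).succ p : Set (M.Path w)) := by
    intro q hq r hr hqr
    obtain ⟨x, hx, rfl⟩ := Path.step_iff.1 ((M.unravel w).mem_succ.1 hq)
    obtain ⟨y, hy, rfl⟩ := Path.step_iff.1 ((M.unravel w).mem_succ.1 hr)
    rw [Path.last_snoc, Path.last_snoc] at hqr
    subst hqr
    rfl
  rw [← Finset.image_val_of_injOn hinj]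
  congr 1
  ext x
  rw [Finset.mem_image, mem_succ]
  constructor
  · rintro ⟨q, hq, rfl⟩
    obtain ⟨y, hy, rfl⟩ := Path.step_iff.1 ((M.unravel w).mem_succ.1 hq)
    rwa [Path.last_snoc]
  · exact fun hx => ⟨p.snoc x hx, (M.unravel w).mem_succ.2 (Path.step_snoc p hx), Path.last_snoc p hx⟩

theorem code_unravel [Finite Sig] (t : ℕ) (w : M.W) (p : M.Path w) :
    (M.unravel w).code t p = M.code t p.last := by
  induction t generalizing p with
  | zero => rfl
  | succ t ih =>
    refine code_succ_eq_iff.2 ⟨rfl, ?_⟩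
    rw [← map_last_succ_unravel, Multiset.map_map]
    exact Multiset.map_congr rfl fun q _ => ih q

end KripkeModel

/-- The unravelling of a pointed model. -/
def PointedModel.unravel (N : PointedModel.{u, v} Sig) : PointedModel.{u, v} Sig :=
  ⟨N.M.unravel N.w, .nil N.w⟩

end Unravelling

/-! ### Types of monadic second-order logic -/

section Types

/-- The possible types of rank `0` of pointed models with `m` distinguished sets of nodes. They
tell which of the sets contain the root, which have a common node, which have a node satisfying
which proposition symbol, which are linked by an edge, and which have at least two nodes. -/
abbrev AtomicType (Sig : Type v) (m : ℕ) : Type v :=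
  Set (Fin m) × Set (Fin m × Fin m) × Set (Fin m × Sig) × Set (Fin m × Fin m) × Set (Fin m)

/-- The possible types of rank `k` of pointed models with `m` distinguished sets of nodes. -/
def MSOType (Sig : Type v) : ℕ → ℕ → Type v
  | 0, m => AtomicType Sig m
  | k + 1, m => Set (MSOType Sig k (m + 1))

variable {Sig : Type v}

instance MSOType.finite [Finite Sig] (k m : ℕ) : Finite (MSOType Sig k m) := by
  induction k generalizing m with
  | zero => unfold MSOType; infer_instance
  | succ k ih =>
    have := ih (m + 1)
    unfold MSOType; infer_instance

/-- The type of rank `0` of a pointed model with distinguished sets of nodes. -/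
def KripkeModel.atomicType (M : KripkeModel.{u, v} Sig) (a : M.W) {m : ℕ} (E : Fin m → Set M.W) :
    AtomicType Sig m :=
  ({i | a ∈ E i}, {i | ∃ x, x ∈ E i.1 ∧ x ∈ E i.2},
    {i | ∃ x, x ∈ E i.1 ∧ i.2 ∈ M.V x}, {i | ∃ x y, x ∈ E i.1 ∧ y ∈ E i.2 ∧ M.R x y},
    {i | ∃ x y, x ∈ E i ∧ y ∈ E i ∧ x ≠ y})

/-- The type of rank `k` of a pointed model with distinguished sets of nodes. -/
def KripkeModel.msoType (M : KripkeModel.{u, v} Sig) (a : M.W) :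
    (k m : ℕ) → (Fin m → Set M.W) → MSOType Sig k m
  | 0, _, E => M.atomicType a E
  | k + 1, m, E => Set.range fun A : Set M.W => M.msoType a k (m + 1) (Fin.cons A E)

namespace KripkeModel

variable {M M' : KripkeModel.{u, v} Sig} {a : M.W} {a' : M'.W}

theorem msoType_zero_eq_iff {m : ℕ} {E : Fin m → Set M.W} {E' : Fin m → Set M'.W} :
    M.msoType a 0 m E = M'.msoType a' 0 m E' ↔
      (∀ i, a ∈ E i ↔ a' ∈ E' i) ∧
      (∀ i j, (∃ x, x ∈ E i ∧ x ∈ E j) ↔ ∃ x, x ∈ E' i ∧ x ∈ E' j) ∧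
      (∀ i p, (∃ x, x ∈ E i ∧ p ∈ M.V x) ↔ ∃ x, x ∈ E' i ∧ p ∈ M'.V x) ∧
      (∀ i j, (∃ x y, x ∈ E i ∧ y ∈ E j ∧ M.R x y) ↔ ∃ x y, x ∈ E' i ∧ y ∈ E' j ∧ M'.R x y) ∧
      (∀ i, (∃ x y, x ∈ E i ∧ y ∈ E i ∧ x ≠ y) ↔ ∃ x y, x ∈ E' i ∧ y ∈ E' i ∧ x ≠ y) := by
  change M.atomicType a E = M'.atomicType a' E' ↔ _
  simp only [atomicType, Prod.mk.injEq, Set.ext_iff, Set.mem_ofPred_eq, Prod.forall]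

theorem msoType_succ_eq_iff {k m : ℕ} {E : Fin m → Set M.W} {E' : Fin m → Set M'.W} :
    M.msoType a (k + 1) m E = M'.msoType a' (k + 1) m E' ↔
      (∀ A : Set M.W, ∃ A' : Set M'.W, M.msoType a k (m + 1) (Fin.cons A E) =
        M'.msoType a' k (m + 1) (Fin.cons A' E')) ∧
      ∀ A' : Set M'.W, ∃ A : Set M.W, M.msoType a k (m + 1) (Fin.cons A E) =
        M'.msoType a' k (m + 1) (Fin.cons A' E') := by
  change Set.range _ = Set.range _ ↔ _
  rw [Set.Subset.antisymm_iff, Set.range_subset_iff, Set.range_subset_iff]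
  simp only [Set.mem_range, eq_comm]

/-- Play an arbitrary extra set (at the bottom rank, the empty one) and forget it. -/
theorem msoType_eq_of_succ {k m : ℕ} {E : Fin m → Set M.W} {E' : Fin m → Set M'.W}
    (h : M.msoType a (k + 1) m E = M'.msoType a' (k + 1) m E') :
    M.msoType a k m E = M'.msoType a' k m E' := by
  induction k generalizing m with
  | zero =>
    obtain ⟨A', hA⟩ := (msoType_succ_eq_iff.1 h).1 ∅
    rw [msoType_zero_eq_iff] at hA ⊢
    obtain ⟨h1, h2, h3, h4, h5⟩ := hA
    exact ⟨fun i => h1 i.succ, fun i j => h2 i.succ j.succ, fun i => h3 i.succ,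
      fun i j => h4 i.succ j.succ, fun i => h5 i.succ⟩
  | succ k ih =>
    rw [msoType_succ_eq_iff] at h ⊢
    exact ⟨fun A => (h.1 A).imp fun _ => ih, fun A => (h.2 A).imp fun _ => ih⟩

theorem msoType_zero_eq {k m : ℕ} {E : Fin m → Set M.W} {E' : Fin m → Set M'.W}
    (h : M.msoType a k m E = M'.msoType a' k m E') :
    M.msoType a 0 m E = M'.msoType a' 0 m E' := by
  induction k with
  | zero => exact h
  | succ k ih => exact ih (msoType_eq_of_succ h)

/-- Types of rank 0 record nonemptiness and the presence of two nodes, so being a singleton is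
visible at every rank. This lets set moves simulate first-order quantifiers. -/
theorem exists_eq_singleton_of_msoType_eq {k m : ℕ} {E : Fin m → Set M.W} {E' : Fin m → Set M'.W}
    {b : M.W} {B : Set M'.W} (hB : M.msoType a k (m + 1) (Fin.cons {b} E) =
      M'.msoType a' k (m + 1) (Fin.cons B E')) : ∃ b', B = {b'} := by
  have h0 := msoType_zero_eq_iff.1 (msoType_zero_eq hB)
  obtain ⟨b', hb', -⟩ := (h0.2.1 0 0).1 ⟨b, rfl, rfl⟩
  refine ⟨b', Set.Subset.antisymm (fun c hc => ?_) (by simpa using hb')⟩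
  by_contra hcb
  obtain ⟨x, y, hx, hy, hxy⟩ := (h0.2.2.2.2 0).2 ⟨c, b', hc, hb', hcb⟩
  exact hxy (Eq.trans hx (Eq.symm hy))

/-- Types are invariant under isomorphisms. -/
theorem msoType_eq_of_equiv (f : M.W ≃ M'.W) (hR : ∀ x y, M'.R (f x) (f y) ↔ M.R x y)
    (hV : ∀ x, M'.V (f x) = M.V x) (k m : ℕ) (E : Fin m → Set M'.W) :
    M.msoType a k m (fun i => f ⁻¹' E i) = M'.msoType (f a) k m E := by
  induction k generalizing m with
  | zero =>
    rw [msoType_zero_eq_iff]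
    simp only [← f.exists_congr_right, Set.mem_preimage, hR, hV, ne_eq,
      f.injective.eq_iff, implies_true, and_self]
  | succ k ih =>
    have hcons : ∀ A : Set M'.W, (Fin.cons (f ⁻¹' A) fun i => f ⁻¹' E i : Fin (m + 1) → Set M.W) =
        fun i => f ⁻¹' (Fin.cons A E : Fin (m + 1) → Set M'.W) i := by
      intro A
      funext i
      cases i using Fin.cases <;> rfl
    refine msoType_succ_eq_iff.2 ⟨fun A => ⟨f '' A, ?_⟩, fun A => ⟨f ⁻¹' A, ?_⟩⟩
    · rw [← ih, ← hcons, f.preimage_image]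
    · rw [← ih, ← hcons]

end KripkeModel

/-- The quantifier rank of a formula. -/
def MSO.rank : {n m : ℕ} → MSO Sig n m → ℕ
  | _, _, .prop _ _ => 0
  | _, _, .rel _ _ => 0
  | _, _, .eq _ _ => 0
  | _, _, .mem _ _ => 0
  | _, _, .neg φ => φ.rank
  | _, _, .and φ ψ => max φ.rank ψ.rank
  | _, _, .ex φ => φ.rank + 1
  | _, _, .exSet φ => φ.rank + 1

/-- An Ehrenfeucht–Fraïssé argument with set moves only. The maps `α` and `β` tell which
distinguished set interprets each variable, first-order ones being coded by singletons; the answer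
to a singleton is a singleton. -/
theorem MSO.sat_iff_of_msoType_eq {n m : ℕ} (φ : MSO Sig n m) {M M' : KripkeModel.{u, v} Sig}
    {a : M.W} {a' : M'.W} {k l : ℕ} (hk : φ.rank ≤ k) (α : Fin n → Fin l) (β : Fin m → Fin l)
    {E : Fin l → Set M.W} {E' : Fin l → Set M'.W} {e : Fin n → M.W} {e' : Fin n → M'.W}
    (he : ∀ i, E (α i) = {e i}) (he' : ∀ i, E' (α i) = {e' i})
    (h : M.msoType a k l E = M'.msoType a' k l E') :
    φ.Sat M e (fun j => E (β j)) ↔ φ.Sat M' e' (fun j => E' (β j)) := by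
  induction φ generalizing k l with
  | prop p x =>
    have := (KripkeModel.msoType_zero_eq_iff.1 (KripkeModel.msoType_zero_eq h)).2.2.1 (α x) p
    simpa [he, he', MSO.Sat] using this
  | rel x y =>
    have := (KripkeModel.msoType_zero_eq_iff.1 (KripkeModel.msoType_zero_eq h)).2.2.2.1 (α x) (α y)
    simpa [he, he', MSO.Sat] using this
  | eq x y =>
    have := (KripkeModel.msoType_zero_eq_iff.1 (KripkeModel.msoType_zero_eq h)).2.1 (α x) (α y)
    simpa [he, he', MSO.Sat] using this
  | mem x X =>
    have := (KripkeModel.msoType_zero_eq_iff.1 (KripkeModel.msoType_zero_eq h)).2.1 (α x) (β X)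
    simpa [he, he', MSO.Sat] using this
  | neg φ ih => exact not_congr (ih hk α β he he' h)
  | and φ ψ ihφ ihψ =>
    exact and_congr (ihφ ((le_max_left _ _).trans hk) α β he he' h)
      (ihψ ((le_max_right _ _).trans hk) α β he he' h)
  | @ex n m φ ih =>
    obtain ⟨k, rfl⟩ := Nat.exists_eq_add_of_le' (le_trans (Nat.le_add_left 1 _) hk)
    have hk' : φ.rank ≤ k := Nat.le_of_succ_le_succ hk
    have hE : ∀ {X : Type u} (b : X) {F : Fin l → Set X} {f : Fin n → X}
        (_ : ∀ i, F (α i) = {f i}) (i : Fin (n + 1)),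
        (Fin.cons {b} F : Fin (l + 1) → Set X) ((Fin.cons 0 fun i => (α i).succ :
          Fin (n + 1) → Fin (l + 1)) i) = {(Fin.cons b f : Fin (n + 1) → X) i} := by
      intro X b F f hF i
      cases i using Fin.cases with
      | zero => rfl
      | succ i => simpa using hF i
    have step : ∀ b b', M.msoType a k (l + 1) (Fin.cons {b} E) =
        M'.msoType a' k (l + 1) (Fin.cons {b'} E') →
        (φ.Sat M (Fin.cons b e) (fun j => E (β j)) ↔
          φ.Sat M' (Fin.cons b' e') (fun j => E' (β j))) := fun b b' hb =>
      ih hk' (Fin.cons 0 fun i => (α i).succ) (fun j => (β j).succ) (hE b he) (hE b' he') hb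
    constructor
    · rintro ⟨b, hb⟩
      obtain ⟨B, hB⟩ := (KripkeModel.msoType_succ_eq_iff.1 h).1 {b}
      obtain ⟨b', rfl⟩ := KripkeModel.exists_eq_singleton_of_msoType_eq hB
      exact ⟨b', (step b b' hB).1 hb⟩
    · rintro ⟨b', hb'⟩
      obtain ⟨B, hB⟩ := (KripkeModel.msoType_succ_eq_iff.1 h).2 {b'}
      obtain ⟨b, rfl⟩ := KripkeModel.exists_eq_singleton_of_msoType_eq hB.symm
      exact ⟨b, (step b b' hB).2 hb'⟩
  | @exSet n m φ ih =>
    obtain ⟨k, rfl⟩ := Nat.exists_eq_add_of_le' (le_trans (Nat.le_add_left 1 _) hk)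
    have hk' : φ.rank ≤ k := Nat.le_of_succ_le_succ hk
    have hE : ∀ {X : Type u} (B : Set X) (F : Fin l → Set X),
        (fun j => (Fin.cons B F : Fin (l + 1) → Set X) ((Fin.cons 0 fun j => (β j).succ :
          Fin (m + 1) → Fin (l + 1)) j)) = Fin.cons B fun j => F (β j) := by
      intro X B F
      funext j
      cases j using Fin.cases <;> simp
    have step : ∀ B B', M.msoType a k (l + 1) (Fin.cons B E) =
        M'.msoType a' k (l + 1) (Fin.cons B' E') →
        (φ.Sat M e (Fin.cons B fun j => E (β j)) ↔
          φ.Sat M' e' (Fin.cons B' fun j => E' (β j))) := fun B B' hB => by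
      have := ih hk' (fun i => (α i).succ) (Fin.cons 0 fun j => (β j).succ)
        (E := Fin.cons B E) (E' := Fin.cons B' E') he he' hB
      rwa [hE, hE] at this
    constructor
    · rintro ⟨B, hB⟩
      obtain ⟨B', h'⟩ := (KripkeModel.msoType_succ_eq_iff.1 h).1 B
      exact ⟨B', (step B B' h').1 hB⟩
    · rintro ⟨B', hB'⟩
      obtain ⟨B, h'⟩ := (KripkeModel.msoType_succ_eq_iff.1 h).2 B'
      exact ⟨B, (step B B' h').2 hB'⟩

end Types

/-! ### The composition theorem for unravellings -/

section Composition

variable {Sig : Type v}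

/-- The threshold up to which successors of the same type have to be counted. -/
noncomputable def msoThreshold (Sig : Type v) : ℕ → ℕ → ℕ
  | 0, _ => 2
  | k + 1, m => msoThreshold Sig k (m + 1) * Nat.card (MSOType Sig k (m + 1)) + 1

theorem msoThreshold_pos (k m : ℕ) : 0 < msoThreshold Sig k m := by
  cases k <;> simp [msoThreshold]

namespace KripkeModel

variable {M M' : KripkeModel.{u, v} Sig}

/-- The sets of paths from a successor that are obtained by restricting sets of paths. -/
def Path.restrict {w : M.W} {m : ℕ} (E : Fin m → Set (M.Path w)) (x : M.W) (i : Fin m) :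
    Set (M.Path x) :=
  {p | ∃ h : M.R w x, Path.cons x h p ∈ E i}

/-- The types of the subtrees at the children of the root of an unravelling. -/
def childType (M : KripkeModel.{u, v} Sig) (w : M.W) (k m : ℕ) (E : Fin m → Set (M.Path w))
    (x : M.W) : MSOType Sig k m :=
  (M.unravel x).msoType (Path.nil x) k m (Path.restrict E x)

/-- The multiset of the types of the subtrees at the children of the root of an unravelling. -/
noncomputable def childTypes (M : KripkeModel.{u, v} Sig) (w : M.W) (k m : ℕ)
    (E : Fin m → Set (M.Path w)) : Multiset (MSOType Sig k m) :=
  (M.succ w).val.map (M.childType w k m E)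

theorem mem_childTypes {w : M.W} {k m : ℕ} {E : Fin m → Set (M.Path w)} {τ : MSOType Sig k m} :
    τ ∈ M.childTypes w k m E ↔ ∃ x, M.R w x ∧ M.childType w k m E x = τ := by
  simp only [childTypes, Multiset.mem_map, Finset.mem_val, mem_succ]

/-- The case `σ = τ` is included and asks for multiplicity two. -/
theorem pair_le_childTypes {w : M.W} {k m : ℕ} {E : Fin m → Set (M.Path w)}
    {σ τ : MSOType Sig k m} :
    σ ::ₘ τ ::ₘ 0 ≤ M.childTypes w k m E ↔ ∃ x y, M.R w x ∧ M.R w y ∧ x ≠ y ∧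
      M.childType w k m E x = σ ∧ M.childType w k m E y = τ := by
  classical
  constructor
  · intro h
    obtain ⟨x, hx, rfl⟩ := mem_childTypes.1 (Multiset.mem_of_le h (Multiset.mem_cons_self _ _))
    obtain ⟨s, hs⟩ := Multiset.exists_cons_of_mem (M.mem_succ_val.2 hx)
    rw [childTypes, hs, Multiset.map_cons, Multiset.cons_le_cons_iff] at h
    obtain ⟨y, hy, rfl⟩ :=
      Multiset.mem_map.1 (Multiset.mem_of_le h (Multiset.mem_cons_self _ _))
    have hnd := (M.succ w).nodup
    rw [hs, Multiset.nodup_cons] at hnd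
    have hyw : y ∈ (M.succ w).val := hs ▸ Multiset.mem_cons_of_mem hy
    exact ⟨x, y, hx, M.mem_succ_val.1 hyw, fun hxy => hnd.1 (hxy ▸ hy), rfl, rfl⟩
  · rintro ⟨x, y, hx, hy, hxy, rfl, rfl⟩
    have : x ::ₘ y ::ₘ 0 ≤ (M.succ w).val := by
      rw [Multiset.le_iff_subset (by simpa using hxy)]
      intro z hz
      simp only [Multiset.mem_cons, Multiset.notMem_zero, or_false] at hz
      rcases hz with rfl | rfl
      · exact M.mem_succ_val.2 hx
      · exact M.mem_succ_val.2 hy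
    simpa [childTypes] using Multiset.map_le_map (f := M.childType w k m E) this

/-- Each atomic fact lives at the root, on the edge to one child, inside one subtree, or, for two
distinct nodes, possibly in two subtrees. Hence counting child types up to 2 suffices at rank 0. -/
theorem atomic_imp_of_agree {w : M.W} {w' : M'.W} {m : ℕ} {E : Fin m → Set (M.Path w)}
    {E' : Fin m → Set (M'.Path w')} (hV : M.V w = M'.V w')
    (hroot : ∀ i, Path.nil w ∈ E i ↔ Path.nil w' ∈ E' i)
    (h : Multiset.AgreeUpTo 2 (M.childTypes w 0 m E) (M'.childTypes w' 0 m E')) :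
    (∀ i j, (∃ x, x ∈ E i ∧ x ∈ E j) → ∃ x, x ∈ E' i ∧ x ∈ E' j) ∧
    (∀ i p, (∃ x, x ∈ E i ∧ p ∈ M.V x.last) → ∃ x, x ∈ E' i ∧ p ∈ M'.V x.last) ∧
    (∀ i j, (∃ x y, x ∈ E i ∧ y ∈ E j ∧ Path.Step x y) →
      ∃ x y, x ∈ E' i ∧ y ∈ E' j ∧ Path.Step x y) ∧
    (∀ i, (∃ x y, x ∈ E i ∧ y ∈ E i ∧ x ≠ y) → ∃ x y, x ∈ E' i ∧ y ∈ E' i ∧ x ≠ y) := by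
  classical
  have one : ∀ x, M.R w x → ∃ x', M'.R w' x' ∧
      M'.childType w' 0 m E' x' = M.childType w 0 m E x := fun x hx =>
    mem_childTypes.1 ((h.mem_iff two_pos _).1 (mem_childTypes.2 ⟨x, hx, rfl⟩))
  have two : ∀ x y, M.R w x → M.R w y → x ≠ y → ∃ x' y', M'.R w' x' ∧ M'.R w' y' ∧ x' ≠ y' ∧
      M'.childType w' 0 m E' x' = M.childType w 0 m E x ∧
      M'.childType w' 0 m E' y' = M.childType w 0 m E y := fun x y hx hy hxy =>
    pair_le_childTypes.1 ((h.le_iff_le fun a => (Multiset.count_le_card _ _).trans (by simp)).1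
      (pair_le_childTypes.2 ⟨x, y, hx, hy, hxy, rfl, rfl⟩))
  refine ⟨?_, ?_, ?_, ?_⟩
  · rintro i j ⟨x, hi, hj⟩
    cases x with
    | nil => exact ⟨_, (hroot i).1 hi, (hroot j).1 hj⟩
    | cons x hx q =>
      obtain ⟨x', hx', hτ⟩ := one x hx
      obtain ⟨q', ⟨_, hi'⟩, ⟨_, hj'⟩⟩ :=
        ((msoType_zero_eq_iff.1 hτ).2.1 i j).2 ⟨q, ⟨hx, hi⟩, ⟨hx, hj⟩⟩
      exact ⟨_, hi', hj'⟩
  · rintro i p ⟨x, hi, hp⟩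
    cases x with
    | nil => exact ⟨_, (hroot i).1 hi, (hV ▸ hp : p ∈ M'.V w')⟩
    | cons x hx q =>
      obtain ⟨x', hx', hτ⟩ := one x hx
      obtain ⟨q', ⟨_, hi'⟩, hp'⟩ :=
        ((msoType_zero_eq_iff.1 hτ).2.2.1 i p).2 ⟨q, ⟨hx, hi⟩, hp⟩
      exact ⟨_, hi', hp'⟩
  · rintro i j ⟨x, y, hi, hj, hs⟩
    cases hs with
    | @nil _ x hx =>
      obtain ⟨x', hx', hτ⟩ := one x hx
      obtain ⟨_, hj'⟩ := ((msoType_zero_eq_iff.1 hτ).1 j).2 ⟨hx, hj⟩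
      exact ⟨_, _, (hroot i).1 hi, hj', .nil _⟩
    | @cons _ x hx p q hs =>
      obtain ⟨x', hx', hτ⟩ := one x hx
      obtain ⟨p', q', ⟨_, hi'⟩, ⟨_, hj'⟩, hs'⟩ :=
        ((msoType_zero_eq_iff.1 hτ).2.2.2.1 i j).2 ⟨p, q, ⟨hx, hi⟩, ⟨hx, hj⟩, hs⟩
      exact ⟨_, _, hi', hj', .cons _ hs'⟩
  · have rootCase : ∀ i x (hx : M.R w x) (q : M.Path x), Path.nil w ∈ E i →
        Path.cons x hx q ∈ E i → ∃ x y, x ∈ E' i ∧ y ∈ E' i ∧ x ≠ y := by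
      intro i x hx q hn hq
      obtain ⟨x', hx', hτ⟩ := one x hx
      obtain ⟨q', ⟨_, hq'⟩, -⟩ :=
        ((msoType_zero_eq_iff.1 hτ).2.1 i i).2 ⟨q, ⟨hx, hq⟩, ⟨hx, hq⟩⟩
      exact ⟨_, _, (hroot i).1 hn, hq', nofun⟩
    rintro i ⟨x, y, hx, hy, hxy⟩
    cases x with
    | nil =>
      cases y with
      | nil => exact absurd rfl hxy
      | cons y hwy q => exact rootCase i y hwy q hx hy
    | cons x hwx p =>
      cases y with
      | nil => exact rootCase i x hwx p hy hx
      | cons y hwy q =>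
        by_cases hne : x = y
        · subst hne
          obtain ⟨x', hx', hτ⟩ := one x hwx
          obtain ⟨p', q', ⟨_, hp'⟩, ⟨_, hq'⟩, hpq'⟩ :=
            ((msoType_zero_eq_iff.1 hτ).2.2.2.2 i).2 ⟨p, q, ⟨hwx, hx⟩, ⟨hwy, hy⟩,
              fun hpq => hxy (hpq ▸ rfl)⟩
          refine ⟨_, _, hp', hq', fun heq => hpq' ?_⟩
          cases heq
          rfl
        · obtain ⟨x', y', hx', hy', hne', hτ, hσ⟩ := two x y hwx hwy hne
          obtain ⟨p', ⟨_, hp'⟩, -⟩ :=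
            ((msoType_zero_eq_iff.1 hτ).2.1 i i).2 ⟨p, ⟨hwx, hx⟩, ⟨hwx, hx⟩⟩
          obtain ⟨q', ⟨_, hq'⟩, -⟩ :=
            ((msoType_zero_eq_iff.1 hσ).2.1 i i).2 ⟨q, ⟨hwy, hy⟩, ⟨hwy, hy⟩⟩
          refine ⟨_, _, hp', hq', fun heq => hne' ?_⟩
          cases heq
          rfl

/-- A set of paths given by the membership of the trivial path and by sets of paths from the
successors. -/
def Path.glue {w : M.W} (r : Prop) (B : ∀ x : M.W, Set (M.Path x)) : Set (M.Path w) :=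
  {p | match p with
    | .nil _ => r
    | .cons x _ q => q ∈ B x}

/-- One move of the game. A set `A` amounts to a bit at the root and a trace on each child subtree.
Each child is labelled by its rank `k` type with the trace added; the labels are transferred to the
children of `w'`, realised there by sets, and glued. The recursion for `msoThreshold` is exactly
what the transfer needs. The hypothesis `ih` is a parameter so that the move can be played from
either side. -/
theorem exists_msoType_unravel_eq [Finite Sig] {w : M.W} {w' : M'.W} {k m : ℕ}
    (ih : ∀ {E : Fin (m + 1) → Set (M.Path w)} {E' : Fin (m + 1) → Set (M'.Path w')},
      (∀ i, Path.nil w ∈ E i ↔ Path.nil w' ∈ E' i) →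
      Multiset.AgreeUpTo (msoThreshold Sig k (m + 1)) (M.childTypes w k (m + 1) E)
        (M'.childTypes w' k (m + 1) E') →
      (M.unravel w).msoType (Path.nil w) k (m + 1) E =
        (M'.unravel w').msoType (Path.nil w') k (m + 1) E')
    {E : Fin m → Set (M.Path w)} {E' : Fin m → Set (M'.Path w')}
    (hroot : ∀ i, Path.nil w ∈ E i ↔ Path.nil w' ∈ E' i)
    (h : Multiset.AgreeUpTo (msoThreshold Sig (k + 1) m) (M.childTypes w (k + 1) m E)
      (M'.childTypes w' (k + 1) m E')) (A : Set (M.Path w)) :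
    ∃ A' : Set (M'.Path w'), (M.unravel w).msoType (Path.nil w) k (m + 1) (Fin.cons A E) =
      (M'.unravel w').msoType (Path.nil w') k (m + 1) (Fin.cons A' E') := by
  classical
  set p : Multiset (MSOType Sig k (m + 1) × MSOType Sig (k + 1) m) :=
    (M.succ w).val.map fun x => (M.childType w k (m + 1) (Fin.cons A E) x,
      M.childType w (k + 1) m E x) with hp
  have hfst : p.map Prod.fst = M.childTypes w k (m + 1) (Fin.cons A E) := by
    rw [hp, Multiset.map_map]; rfl
  have hsnd : p.map Prod.snd = M.childTypes w (k + 1) m E := by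
    rw [hp, Multiset.map_map]; rfl
  rw [← hsnd] at h
  obtain ⟨q, hq, hqp⟩ := h.exists_pairs
  have : Nonempty (MSOType Sig k (m + 1)) := ⟨M.childType w k (m + 1) (Fin.cons A E) w⟩
  obtain ⟨g, rfl⟩ := Multiset.exists_eq_map_pair_of_map_snd_eq _ _ q hq
  have hB : ∀ x, M'.R w' x → ∃ B : Set (M'.Path x),
      (M'.unravel x).msoType (Path.nil x) k (m + 1) (Fin.cons B (Path.restrict E' x)) = g x := by
    -- The label `g x` also occurs at a child `y` of `w` with the same type of rank `k + 1`; the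
    -- answer in the subtree at `x` to the trace of `A` at `y` realises it.
    intro x hx
    have hmem := (hqp.mem_iff (msoThreshold_pos _ _) _).1
      (Multiset.mem_map_of_mem _ (M'.mem_succ_val.2 hx))
    obtain ⟨y, hy, hyx⟩ := Multiset.mem_map.1 hmem
    rw [Prod.mk.injEq] at hyx
    have hy' : M.R w y := M.mem_succ_val.1 hy
    have hcons : Path.restrict (Fin.cons A E : Fin (m + 1) → Set (M.Path w)) y =
        Fin.cons {r | Path.cons y hy' r ∈ A} (Path.restrict E y) := by
      funext i
      cases i using Fin.cases with
      | zero =>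
        ext r
        exact ⟨fun ⟨_, hr⟩ => hr, fun hr => ⟨hy', hr⟩⟩
      | succ i => rfl
    obtain ⟨B, hB⟩ := (msoType_succ_eq_iff.1 hyx.2).1 {r | Path.cons y hy' r ∈ A}
    refine ⟨B, hB.symm.trans (Eq.trans ?_ hyx.1)⟩
    rw [childType, hcons]
  choose! B hB using hB
  refine ⟨Path.glue (Path.nil w ∈ A) B, ih (fun i => ?_) ?_⟩
  · cases i using Fin.cases with
    | zero => exact Iff.rfl
    | succ i => exact hroot i
  · rw [← hfst]
    refine (hqp.map Prod.fst).symm.trans ?_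
    convert Multiset.AgreeUpTo.refl _ _ using 1
    rw [Multiset.map_map]
    refine Multiset.map_congr rfl fun x hx => ?_
    have hx' : M'.R w' x := M'.mem_succ_val.1 hx
    rw [Function.comp_apply, ← hB x hx', childType]
    congr 1
    funext i
    cases i using Fin.cases with
    | zero =>
      ext r
      exact ⟨fun ⟨_, hr⟩ => hr, fun hr => ⟨hx', hr⟩⟩
    | succ i => rfl

/-- The type of an unravelling is determined by the root and the types of the subtrees at its
children, counted up to a threshold. -/
theorem msoType_unravel_eq [Finite Sig] {w : M.W} {w' : M'.W} (hV : M.V w = M'.V w') (k : ℕ) :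
    ∀ {m : ℕ} {E : Fin m → Set (M.Path w)} {E' : Fin m → Set (M'.Path w')},
    (∀ i, Path.nil w ∈ E i ↔ Path.nil w' ∈ E' i) →
    Multiset.AgreeUpTo (msoThreshold Sig k m) (M.childTypes w k m E) (M'.childTypes w' k m E') →
    (M.unravel w).msoType (Path.nil w) k m E = (M'.unravel w').msoType (Path.nil w') k m E' := by
  induction k with
  | zero =>
    intro m E E' hroot h
    obtain ⟨h1, h2, h3, h4⟩ := atomic_imp_of_agree hV hroot h
    obtain ⟨h1', h2', h3', h4'⟩ := atomic_imp_of_agree hV.symm (fun i => (hroot i).symm) h.symm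
    exact msoType_zero_eq_iff.2 ⟨hroot, fun i j => ⟨h1 i j, h1' i j⟩, fun i p => ⟨h2 i p, h2' i p⟩,
      fun i j => ⟨h3 i j, h3' i j⟩, fun i => ⟨h4 i, h4' i⟩⟩
  | succ k ih =>
    intro m E E' hroot h
    refine msoType_succ_eq_iff.2 ⟨exists_msoType_unravel_eq ih hroot h, fun A' => ?_⟩
    obtain ⟨A, hA⟩ := exists_msoType_unravel_eq
      (fun hr ha => (ih (fun i => (hr i).symm) ha.symm).symm) (fun i => (hroot i).symm) h.symm A'
    exact ⟨A, hA.symm⟩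

end KripkeModel

end Composition

/-! ### Generated submodels and joins -/

section Join

variable {Sig : Type v}

namespace KripkeModel

/-- Embeddings onto generated submodels. -/
structure IsGeneratedEmbedding (M M' : KripkeModel.{u, v} Sig) (f : M.W → M'.W) : Prop where
  injective : Function.Injective f
  V_eq : ∀ x, M'.V (f x) = M.V x
  R_iff : ∀ x y, M'.R (f x) y ↔ ∃ z, y = f z ∧ M.R x z

namespace IsGeneratedEmbedding

variable {M M' : KripkeModel.{u, v} Sig} {f : M.W → M'.W}

theorem R_apply (hf : IsGeneratedEmbedding M M' f) {x y : M.W} : M'.R (f x) (f y) ↔ M.R x y := by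
  rw [hf.R_iff]
  exact ⟨fun ⟨z, hz, h⟩ => hf.injective hz ▸ h, fun h => ⟨y, rfl, h⟩⟩

theorem succ_val (hf : IsGeneratedEmbedding M M' f) (x : M.W) :
    (M'.succ (f x)).val = (M.succ x).val.map f := by
  have : M'.succ (f x) = (M.succ x).map ⟨f, hf.injective⟩ := by
    ext y
    simp only [mem_succ, hf.R_iff, Finset.mem_map, Function.Embedding.coeFn_mk]
    exact exists_congr fun z => ⟨fun h => ⟨h.2, h.1.symm⟩, fun h => ⟨h.2.symm, h.1⟩⟩
  rw [this, Finset.map_val, Function.Embedding.coeFn_mk]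

theorem code_apply [Finite Sig] (hf : IsGeneratedEmbedding M M' f) (t : ℕ) (x : M.W) :
    M'.code t (f x) = M.code t x := by
  induction t generalizing x with
  | zero => exact code_zero_eq_iff.2 (hf.V_eq x)
  | succ t ih =>
    refine code_succ_eq_iff.2 ⟨hf.V_eq x, ?_⟩
    rw [hf.succ_val, Multiset.map_map]
    exact Multiset.map_congr rfl fun y _ => ih y

/-- The image of a path. -/
def mapPath (hf : IsGeneratedEmbedding M M' f) : {x : M.W} → M.Path x → M'.Path (f x)
  | x, .nil _ => .nil (f x)
  | _, .cons y h p => .cons (f y) (hf.R_apply.2 h) (hf.mapPath p)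

theorem last_mapPath (hf : IsGeneratedEmbedding M M' f) {x : M.W} (p : M.Path x) : (hf.mapPath p).last = f p.last := by
  induction p with
  | nil x => rfl
  | cons y h p ih => exact ih

theorem mapPath_injective (hf : IsGeneratedEmbedding M M' f) (x : M.W) :
    Function.Injective (hf.mapPath : M.Path x → M'.Path (f x)) := by
  intro p q hpq
  induction p with
  | nil x =>
    cases q with
    | nil => rfl
    | cons y h q => simp [mapPath] at hpq
  | cons y h p ih =>
    cases q with
    | nil => simp [mapPath] at hpq
    | cons z h' q =>
      simp only [mapPath, Path.cons.injEq] at hpq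
      obtain ⟨h1, h2⟩ := hpq
      obtain rfl := hf.injective h1
      rw [ih (eq_of_heq h2)]

theorem mapPath_surjective (hf : IsGeneratedEmbedding M M' f) (x : M.W) :
    Function.Surjective (hf.mapPath : M.Path x → M'.Path (f x)) := by
  -- The starting node is generalised along an equation so that induction on the path is possible.
  have key : ∀ (y : M'.W) (q : M'.Path y) (x : M.W) (h : y = f x),
      ∃ p : M.Path x, hf.mapPath p = h ▸ q := by
    intro y q
    induction q with
    | nil y =>
      rintro x rfl
      exact ⟨.nil x, rfl⟩
    | cons z hz q ih =>
      rintro x rfl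
      obtain ⟨z, rfl, hxz⟩ := (hf.R_iff _ _).1 hz
      obtain ⟨p, rfl⟩ := ih z rfl
      exact ⟨.cons z hxz p, rfl⟩
  exact fun q => key _ q x rfl

theorem step_mapPath_iff (hf : IsGeneratedEmbedding M M' f) {x : M.W} (p q : M.Path x) :
    Path.Step (hf.mapPath p) (hf.mapPath q) ↔ Path.Step p q := by
  constructor
  · intro hs
    obtain ⟨y, hy, hq⟩ := Path.step_iff.1 hs
    have hlast := hf.last_mapPath p
    rw [hlast, hf.R_iff] at hy
    obtain ⟨z, rfl, hz⟩ := hy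
    have snoc : ∀ {x : M.W} (p : M.Path x) (z : M.W) (hz : M.R p.last z)
        (hy : M'.R (hf.mapPath p).last (f z)),
        (hf.mapPath p).snoc (f z) hy = hf.mapPath (p.snoc z hz) := by
      intro x p
      induction p with
      | nil x => intros; rfl
      | cons y h p ih =>
        intro z hz hy
        exact congrArg (Path.cons (f y) (hf.R_apply.2 h)) (ih z hz hy)
    rw [snoc p z hz] at hq
    rw [hf.mapPath_injective x hq]
    exact Path.step_snoc p hz
  · intro hs
    induction hs with
    | nil h => exact .nil _
    | cons h _ ih => exact .cons _ ih

/-- No edge leaves the image of a generated embedding, so the two unravellings are isomorphic trees.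
-/
theorem msoType_unravel (hf : IsGeneratedEmbedding M M' f) (x : M.W) (k : ℕ)
    (E : Fin 0 → Set (M.Path x))
    (E' : Fin 0 → Set (M'.Path (f x))) :
    (M'.unravel (f x)).msoType (Path.nil (f x)) k 0 E' =
      (M.unravel x).msoType (Path.nil x) k 0 E := by
  have h := msoType_eq_of_equiv (M := M.unravel x) (M' := M'.unravel (f x)) (a := Path.nil x)
    (Equiv.ofBijective hf.mapPath ⟨hf.mapPath_injective x, hf.mapPath_surjective x⟩)
    (fun p q => hf.step_mapPath_iff p q)
    (fun p => (congrArg M'.V (hf.last_mapPath p)).trans (hf.V_eq _)) k 0 E'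
  refine Eq.trans h.symm ?_
  congr 1
  exact Subsingleton.elim _ _

end IsGeneratedEmbedding

variable {ι : Type u} (N : ι → PointedModel.{u, v} Sig)

/-- The accessibility relation of the join of a family of pointed models. -/
inductive JoinRel : Option (Σ i, (N i).M.W) → Option (Σ i, (N i).M.W) → Prop
  | root (i : ι) : JoinRel none (some ⟨i, (N i).w⟩)
  | inner (i : ι) {x y : (N i).M.W} : (N i).M.R x y → JoinRel (some ⟨i, x⟩) (some ⟨i, y⟩)

theorem joinRel_some_iff (i : ι) (x : (N i).M.W) (z : Option (Σ i, (N i).M.W)) :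
    JoinRel N (some ⟨i, x⟩) z ↔ ∃ y, z = some ⟨i, y⟩ ∧ (N i).M.R x y := by
  constructor
  · rintro (_ | ⟨_, h⟩)
    exact ⟨_, rfl, h⟩
  · rintro ⟨y, rfl, h⟩
    exact .inner i h

theorem joinRel_none_iff (z : Option (Σ i, (N i).M.W)) :
    JoinRel N none z ↔ ∃ i, some ⟨i, (N i).w⟩ = z := by
  constructor
  · rintro ⟨i⟩
    exact ⟨i, rfl⟩
  · rintro ⟨i, rfl⟩
    exact .root i

variable [Finite ι]

/-- The disjoint union of a finite family of pointed models together with a new root whose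
successors are the distinguished nodes. -/
def join (σ : Set Sig) : KripkeModel.{u, v} Sig where
  W := Option (Σ i, (N i).M.W)
  R := JoinRel N
  V
    | none => σ
    | some x => (N x.1).M.V x.2
  finite_succ
    | none => by
      simp only [joinRel_none_iff]
      exact Set.finite_range fun i => (some ⟨i, (N i).w⟩ : Option (Σ i, (N i).M.W))
    | some ⟨i, x⟩ => by
      refine (((N i).M.finite_succ x).image fun y => some ⟨i, y⟩).subset ?_
      intro z hz
      obtain ⟨y, rfl, hy⟩ := (joinRel_some_iff N i x z).1 hz
      exact ⟨y, hy, rfl⟩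

theorem isGeneratedEmbedding_join (σ : Set Sig) (i : ι) :
    IsGeneratedEmbedding (N i).M (join N σ) fun x => some ⟨i, x⟩ where
  injective _ _ h := eq_of_heq (Sigma.mk.inj (Option.some.inj h)).2
  V_eq _ := rfl
  R_iff x z := joinRel_some_iff N i x z

theorem succ_join_none_val [Fintype ι] (σ : Set Sig) :
    ((join N σ).succ (none : Option (Σ i, (N i).M.W))).val =
      (Finset.univ : Finset ι).val.map fun i => some ⟨i, (N i).w⟩ := by
  have hinj : Function.Injective
      fun i => (some ⟨i, (N i).w⟩ : Option (Σ i, (N i).M.W)) := by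
    intro i j h
    simp only [Option.some.injEq, Sigma.mk.injEq] at h
    exact h.1
  have : (join N σ).succ (none : Option (Σ i, (N i).M.W)) = Finset.univ.map ⟨_, hinj⟩ := by
    ext z
    refine (mem_succ _).trans ((joinRel_none_iff N z).trans (Iff.trans ?_ Finset.mem_map.symm))
    exact exists_congr fun i => ⟨fun h => ⟨Finset.mem_univ i, h⟩, fun h => h.2⟩
  rw [this, Finset.map_val]
  rfl

/-- Indexing the join by the successors of `w` gives its root one child per successor, so
multiplicities match those at `w`. -/
theorem map_succ_join_none {M : KripkeModel.{u, v} Sig} {w : M.W}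
    (N : M.succ w → PointedModel.{u, v} Sig) (σ : Set Sig) {β : Type*} (F : (join N σ).W → β)
    (f : M.W → β) (hF : ∀ x : M.succ w, F (some ⟨x, (N x).w⟩) = f x) :
    ((join N σ).succ (none : Option (Σ i, (N i).M.W))).val.map F = (M.succ w).val.map f := by
  rw [succ_join_none_val, Finset.univ_eq_attach, Finset.attach_val,
    ← Multiset.attach_map_val' (M.succ w).val f]
  exact (Multiset.map_map _ _ _).trans (Multiset.map_congr rfl fun x _ => hF x)

end KripkeModel

end Join

/-! ### Possible types of the models with a given code -/

section PossibleTypes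

variable {Sig : Type v}

namespace KripkeModel

/-- The type of the unravelling of a model from a node. -/
def treeType (M : KripkeModel.{u, v} Sig) (k : ℕ) (w : M.W) : MSOType Sig k 0 :=
  (M.unravel w).msoType (Path.nil w) k 0 fun i => i.elim0

theorem treeType_eq_of_agree [Finite Sig] {M M' : KripkeModel.{u, v} Sig} {k : ℕ} {w : M.W}
    {w' : M'.W} (hV : M.V w = M'.V w')
    (h : Multiset.AgreeUpTo (msoThreshold Sig k 0) ((M.succ w).val.map (M.treeType k))
      ((M'.succ w').val.map (M'.treeType k))) : M.treeType k w = M'.treeType k w' := by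
  refine msoType_unravel_eq hV k (fun i => i.elim0) ?_
  have key : ∀ {M : KripkeModel.{u, v} Sig} {w : M.W},
      M.childTypes w k 0 (fun i => i.elim0) = (M.succ w).val.map (M.treeType k) := by
    intro M w
    refine Multiset.map_congr rfl fun x _ => ?_
    rw [childType, treeType]
    congr 1
    exact Subsingleton.elim _ _
  rwa [key, key]

theorem IsGeneratedEmbedding.treeType_apply {M M' : KripkeModel.{u, v} Sig} {f : M.W → M'.W}
    (hf : IsGeneratedEmbedding M M' f) (k : ℕ) (x : M.W) :
    M'.treeType k (f x) = M.treeType k x :=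
  hf.msoType_unravel x k _ _

end KripkeModel

/-- The types of unravellings of pointed models with a given code. -/
def possibleTypes (Sig : Type v) [Finite Sig] (k t c : ℕ) : Set (MSOType Sig k 0) :=
  {τ | ∃ N : PointedModel.{u, v} Sig, N.M.code t N.w = c ∧ N.M.treeType k N.w = τ}

variable [Finite Sig]

/-- The possible types of a node in round `t`, that is, the types of the unravellings that agree
with the unravelling from the node up to depth `t`. -/
def KripkeModel.possibleTypes (M : KripkeModel.{u, v} Sig) (k t : ℕ) (w : M.W) :
    Set (MSOType Sig k 0) :=
  _root_.possibleTypes.{u, v} Sig k t (M.code t w)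

/-- The threshold up to which the successors with the same set of possible types are counted. -/
noncomputable def possibleThreshold (Sig : Type v) (k : ℕ) : ℕ :=
  msoThreshold Sig k 0 * Nat.card (MSOType Sig k 0) + 1

/-- A completion of the tree at `w` picks a possible type at each successor. The picks are
transferred to the successors of `w'`, realised by separate models, and joined under a new root; the
composition theorem shows that the type is unchanged. The rounds `t` and `t'` may differ, which is
why one set of step rules serves all rounds. -/
theorem KripkeModel.possibleTypes_succ_subset {M M' : KripkeModel.{u, v} Sig} {k t t' : ℕ}
    {w : M.W} {w' : M'.W} (hV : M.V w = M'.V w')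
    (h : Multiset.AgreeUpTo (possibleThreshold Sig k)
      ((M.succ w).val.map (M.possibleTypes k t)) ((M'.succ w').val.map (M'.possibleTypes k t'))) :
    M.possibleTypes k (t + 1) w ⊆ M'.possibleTypes k (t' + 1) w' := by
  classical
  rintro _ ⟨⟨M₁, w₁⟩, hcode, rfl⟩
  obtain ⟨hV₁, hcode⟩ := code_succ_eq_iff.1 hcode
  have : Nonempty (MSOType Sig k 0) := ⟨M.treeType k w⟩
  -- Equal codes match the successors of `w₁` with those of `w`; `g` carries the tree types over
  -- along this matching.
  obtain ⟨g, hg⟩ := Multiset.exists_eq_map_pair_of_map_snd_eq (M.code t) (M.succ w)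
    ((M₁.succ w₁).val.map fun v => (M₁.treeType k v, M₁.code t v))
    (by rw [Multiset.map_map, ← hcode]; rfl)
  have hgfst : (M.succ w).val.map g = (M₁.succ w₁).val.map (M₁.treeType k) := by
    have := congrArg (Multiset.map Prod.fst) hg
    rw [Multiset.map_map, Multiset.map_map] at this
    exact this.symm
  have hgmem : ∀ v ∈ (M.succ w).val, g v ∈ M.possibleTypes k t v := by
    intro v hv
    have hmem := Multiset.mem_map_of_mem (fun i => (g i, M.code t i)) hv
    rw [← hg] at hmem
    obtain ⟨v₁, -, hv₁⟩ := Multiset.mem_map.1 hmem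
    rw [Prod.mk.injEq] at hv₁
    exact ⟨⟨M₁, v₁⟩, hv₁.2, hv₁.1⟩
  set p := (M.succ w).val.map fun v => (g v, M.possibleTypes k t v) with hp
  have hsnd : p.map Prod.snd = (M.succ w).val.map (M.possibleTypes k t) := by
    rw [hp, Multiset.map_map]; rfl
  have hfst : p.map Prod.fst = (M.succ w).val.map g := by
    rw [hp, Multiset.map_map]; rfl
  rw [← hsnd] at h
  obtain ⟨q, hq, hqp⟩ := h.exists_pairs
  obtain ⟨g', rfl⟩ := Multiset.exists_eq_map_pair_of_map_snd_eq _ _ q hq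
  -- The label `g' v` is used at some successor of `w` with the same set of possible types, so it is
  -- possible at `v`.
  have hg' : ∀ v : M'.succ w', ∃ N : PointedModel.{u, v} Sig,
      N.M.code t' N.w = M'.code t' v ∧ N.M.treeType k N.w = g' v := by
    intro v
    obtain ⟨x, hx, hxv⟩ := Multiset.mem_map.1 <| (hqp.mem_iff (msoThreshold_pos _ _) _).1 <|
      Multiset.mem_map_of_mem (fun v => (g' v, M'.possibleTypes k t' v)) v.2
    rw [Prod.mk.injEq] at hxv
    have := hgmem x hx
    rw [hxv.1, hxv.2] at this
    exact this
  choose N hNcode hNtype using hg'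
  refine ⟨⟨join N (M'.V w'), (none : Option (Σ i, (N i).M.W))⟩, ?_, ?_⟩
  · refine code_succ_eq_iff.2 ⟨rfl, map_succ_join_none N _ _ _ fun v => ?_⟩
    rw [← hNcode v]
    exact (isGeneratedEmbedding_join N (M'.V w') v).code_apply t' (N v).w
  · have htype : ((join N (M'.V w')).succ (none : Option (Σ i, (N i).M.W))).val.map
        ((join N (M'.V w')).treeType k) = (M'.succ w').val.map g' :=
      map_succ_join_none N _ _ _ fun v => by
        rw [← hNtype v]
        exact (isGeneratedEmbedding_join N (M'.V w') v).treeType_apply k (N v).w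
    have hagree := hqp.map Prod.fst
    rw [Multiset.map_map, hfst, hgfst] at hagree
    exact treeType_eq_of_agree (hV.symm.trans hV₁.symm) (htype ▸ hagree)

/-- The possible types of a node in the next round are determined by its label and by the
multiset of the current possible types of its successors, up to a threshold. -/
theorem KripkeModel.possibleTypes_succ_eq {M M' : KripkeModel.{u, v} Sig} {k t t' : ℕ}
    {w : M.W} {w' : M'.W} (hV : M.V w = M'.V w')
    (h : Multiset.AgreeUpTo (possibleThreshold Sig k)
      ((M.succ w).val.map (M.possibleTypes k t)) ((M'.succ w').val.map (M'.possibleTypes k t'))) :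
    M.possibleTypes k (t + 1) w = M'.possibleTypes k (t' + 1) w' :=
  (possibleTypes_succ_subset hV h).antisymm (possibleTypes_succ_subset hV.symm h.symm)

end PossibleTypes

/-! ### Boolean combinations of schemata -/

namespace Schema

variable {Sig : Type v} {T : Type}

theorem exists_sat_iff_exists {κ : Type*} [Finite κ] (b : κ → Schema Sig T) :
    ∃ ψ : Schema Sig T, ∀ (M : KripkeModel.{u, v} Sig) (val : T → Set M.W) (w : M.W),
      ψ.Sat M val w ↔ ∃ i, (b i).Sat M val w := by
  classical
  have := Fintype.ofFinite κ
  have key : ∀ s : Finset κ, ∃ ψ : Schema Sig T,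
      ∀ (M : KripkeModel.{u, v} Sig) (val : T → Set M.W) (w : M.W),
        ψ.Sat M val w ↔ ∃ i ∈ s, (b i).Sat M val w := by
    intro s
    induction s using Finset.induction_on with
    | empty => exact ⟨.neg .top, fun M val w => by simp [Sat]⟩
    | insert a s _ ih =>
      obtain ⟨ψ, hψ⟩ := ih
      exact ⟨.or (b a) ψ, fun M val w => by simp [Sat, hψ]⟩
  obtain ⟨ψ, hψ⟩ := key Finset.univ
  exact ⟨ψ, fun M val w => by simp [hψ]⟩

theorem exists_sat_iff_forall {κ : Type*} [Finite κ] (b : κ → Schema Sig T) :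
    ∃ ψ : Schema Sig T, ∀ (M : KripkeModel.{u, v} Sig) (val : T → Set M.W) (w : M.W),
      ψ.Sat M val w ↔ ∀ i, (b i).Sat M val w := by
  obtain ⟨ψ, hψ⟩ := exists_sat_iff_exists.{u} fun i => (b i).neg
  exact ⟨ψ.neg, fun M val w => by simp [Sat, hψ]⟩

/-- Every property of the set of true schemata in a finite family is expressed by a schema. -/
theorem exists_sat_iff_setOf {ι : Type*} [Finite ι] (a : ι → Schema Sig T) (F : Set ι → Prop) :
    ∃ ψ : Schema Sig T, ∀ (M : KripkeModel.{u, v} Sig) (val : T → Set M.W) (w : M.W),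
      ψ.Sat M val w ↔ F {i | (a i).Sat M val w} := by
  classical
  -- Disjunctive normal form: `χ S` says that exactly the schemata indexed by `S` are true.
  choose χ hχ using fun S : {S : Set ι // F S} =>
    exists_sat_iff_forall.{u} fun i => if i ∈ S.1 then a i else (a i).neg
  obtain ⟨ψ, hψ⟩ := exists_sat_iff_exists.{u} χ
  refine ⟨ψ, fun M val w => ?_⟩
  have hS : ∀ S : {S : Set ι // F S}, (χ S).Sat M val w ↔ {i | (a i).Sat M val w} = S.1 := by
    intro S
    rw [hχ, Set.ext_iff]
    refine forall_congr' fun i => ?_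
    split_ifs with hi <;> simp [Sat, hi]
  rw [hψ]
  simp only [hS]
  exact ⟨fun ⟨S, h⟩ => h ▸ S.2, fun h => ⟨⟨_, h⟩, rfl⟩⟩

end Schema

/-! ### The program computing the possible types -/

section Program

variable {Sig : Type v} [Finite Sig]

theorem exists_base_schema (k : ℕ) (S : Set (MSOType Sig k 0)) :
    ∃ ψ : GML Sig, ∀ (M : KripkeModel.{u, v} Sig) (w : M.W),
      ψ.Sat M (fun X => X.elim) w ↔ M.possibleTypes k 0 w = S := by
  obtain ⟨ψ, hψ⟩ := Schema.exists_sat_iff_setOf.{u} (T := Empty) (fun p : Sig => .prop p)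
    fun σ => ∃ (M : KripkeModel.{u, v} Sig) (w : M.W), M.V w = σ ∧ M.possibleTypes k 0 w = S
  refine ⟨ψ, fun M w => ?_⟩
  rw [hψ]
  refine ⟨?_, fun h => ⟨M, w, rfl, h⟩⟩
  rintro ⟨M', w', hV, rfl⟩
  rw [KripkeModel.possibleTypes, KripkeModel.possibleTypes, KripkeModel.code_zero_eq_iff.2]
  exact hV.symm

/-- The schema is allowed to consult the proposition symbols and the diamonds up to the threshold.
It holds if some node, in any model and round, shows the same pattern and has `S` as its next set of
possible types; `possibleTypes_succ_eq` makes this independent of the chosen node. -/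
theorem exists_step_schema (k : ℕ) {n : ℕ} (e : Set (MSOType Sig k 0) ≃ Fin n)
    (S : Set (MSOType Sig k 0)) :
    ∃ ψ : Schema Sig (Fin n), ∀ (M : KripkeModel.{u, v} Sig) (t : ℕ) (w : M.W),
      ψ.Sat M (fun i => {x | e (M.possibleTypes k t x) = i}) w ↔
        M.possibleTypes k (t + 1) w = S := by
  classical
  let a : Sig ⊕ Set (MSOType Sig k 0) × Fin (possibleThreshold Sig k + 1) → Schema Sig (Fin n) :=
    Sum.elim (fun p => .prop p) fun x => .dia x.2 (.var (e x.1))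
  obtain ⟨ψ, hψ⟩ := Schema.exists_sat_iff_setOf.{u} a
    fun σ => ∃ (M : KripkeModel.{u, v} Sig) (t : ℕ) (w : M.W),
      {i | (a i).Sat M (fun i => {x | e (M.possibleTypes k t x) = i}) w} = σ ∧
        M.possibleTypes k (t + 1) w = S
  refine ⟨ψ, fun M t w => ?_⟩
  rw [hψ]
  refine ⟨?_, fun h => ⟨M, t, w, rfl, h⟩⟩
  rintro ⟨M', t', w', hσ, rfl⟩
  rw [Set.ext_iff] at hσ
  refine (KripkeModel.possibleTypes_succ_eq ?_ fun S' => ?_).symm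
  · ext p
    exact hσ (.inl p)
  · have hcount : ∀ j ≤ possibleThreshold Sig k,
        (j ≤ ((M'.succ w').val.map (M'.possibleTypes k t')).count S' ↔
          j ≤ ((M.succ w).val.map (M.possibleTypes k t)).count S') := by
      intro j hj
      have := hσ (.inr (S', ⟨j, Nat.lt_succ_of_le hj⟩))
      simp only [a, Set.mem_ofPred_eq, Sum.elim_inr, Schema.Sat, e.apply_eq_iff_eq,
        KripkeModel.encard_setOf_succ, Nat.cast_le] at this
      simpa only [Multiset.count_map, ← Multiset.countP_eq_card_filter, eq_comm] using this
    -- Testing each truncated multiplicity against the other side gives both inequalities.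
    have h1 := hcount (min (possibleThreshold Sig k)
      (((M'.succ w').val.map (M'.possibleTypes k t')).count S')) (min_le_left _ _)
    have h2 := hcount (min (possibleThreshold Sig k)
      (((M.succ w).val.map (M.possibleTypes k t)).count S')) (min_le_left _ _)
    have : min (possibleThreshold Sig k)
        (((M'.succ w').val.map (M'.possibleTypes k t')).count S') =
        min (possibleThreshold Sig k)
        (((M.succ w).val.map (M.possibleTypes k t)).count S') := by omega
    convert this

/-- There is a program that accepts a node as soon as all its possible types are in `A`. -/
theorem exists_program_possibleTypes_subset (k : ℕ) (A : Set (MSOType Sig k 0)) :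
    ∃ L : GMSCProgram Sig, ∀ N : PointedModel.{u, v} Sig,
      L.Accepts N ↔ ∃ t, N.M.possibleTypes k t N.w ⊆ A := by
  let e := Finite.equivFin (Set (MSOType Sig k 0))
  choose base hbase using fun i => exists_base_schema.{u, v} k (e.symm i)
  choose step hstep using fun i => exists_step_schema.{u, v} k e (e.symm i)
  let L : GMSCProgram Sig := ⟨_, base, step, {i | e.symm i ⊆ A}⟩
  have hext : ∀ (M : KripkeModel.{u, v} Sig) (t : ℕ),
      L.extension M t = fun i => {x | e (M.possibleTypes k t x) = i} := by
    intro M t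
    induction t with
    | zero =>
      funext i
      ext w
      exact (hbase i M w).trans e.eq_symm_apply
    | succ t ih =>
      funext i
      ext w
      simp only [GMSCProgram.extension, ih]
      exact (hstep i M t w).trans e.eq_symm_apply
  refine ⟨L, fun N => ?_⟩
  simp only [GMSCProgram.Accepts, hext]
  refine exists_congr fun t => ⟨?_, fun h => ⟨_, ?_, rfl⟩⟩
  · rintro ⟨_, hj, rfl⟩
    simpa [L] using hj
  · simpa [L] using h

end Program

/-! ### The main theorem -/

theorem MSODefinable.exists_treeType_determines {Sig : Type v}
    {P : NodeProperty.{u, v} Sig} (h : MSODefinable P) : ∃ k, ∀ N N' : PointedModel.{u, v} Sig,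
      N.M.treeType k N.w = N'.M.treeType k N'.w → (N.unravel ∈ P ↔ N'.unravel ∈ P) := by
  obtain ⟨φ, hφ⟩ := h
  -- The extra rank pays for naming the root by a singleton, which interprets the free variable.
  refine ⟨φ.rank + 1, fun N N' hN => ?_⟩
  rw [← hφ, ← hφ]
  obtain ⟨B, hB⟩ := (KripkeModel.msoType_succ_eq_iff.1 hN).1 {KripkeModel.Path.nil N.w}
  obtain ⟨b, rfl⟩ := KripkeModel.exists_eq_singleton_of_msoType_eq hB
  have hb := ((KripkeModel.msoType_zero_eq_iff.1 (KripkeModel.msoType_zero_eq hB)).1 0).1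
    (Set.mem_singleton _)
  obtain rfl : KripkeModel.Path.nil N'.w = b := hb
  have key := φ.sat_iff_of_msoType_eq le_rfl id (fun j : Fin 0 => j.elim0)
    (e := fun _ => KripkeModel.Path.nil N.w) (e' := fun _ => KripkeModel.Path.nil N'.w)
    (fun i => by rw [Fin.fin_one_eq_zero (id i)]; rfl)
    (fun i => by rw [Fin.fin_one_eq_zero (id i)]; rfl) hB
  exact (iff_of_eq (congrArg (φ.Sat _ _) (Subsingleton.elim _ _))).trans
    (key.trans (iff_of_eq (congrArg (φ.Sat _ _) (Subsingleton.elim _ _))))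

section Main

variable {Sig : Type v} [Finite Sig]

/-- Acceptance by a recurrent GNN depends on a finite part of the unravelling only. -/
theorem GNNExpressible.exists_forall_code_eq {P : NodeProperty.{u, v} Sig} (h : GNNExpressible P)
    {N : PointedModel.{u, v} Sig} (hN : N ∈ P) :
    ∃ t, ∀ N' : PointedModel.{u, v} Sig, N'.M.code t N'.w = N.M.code t N.w → N' ∈ P := by
  obtain ⟨d, G, hG⟩ := h
  obtain ⟨t, ht⟩ := (hG N).2 hN
  obtain ⟨f, hf⟩ := RealGNN.exists_feature_eq.{u, v} G t
  refine ⟨t, fun N' hN' => (hG N').1 ⟨t, ?_⟩⟩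
  rwa [hf, hN', ← hf]

/-- A model and its unravelling have the same codes at every depth. -/
theorem GNNExpressible.unravel_mem_iff {P : NodeProperty.{u, v} Sig} (h : GNNExpressible P)
    (N : PointedModel.{u, v} Sig) : N.unravel ∈ P ↔ N ∈ P := by
  have hcode : ∀ t, N.unravel.M.code t N.unravel.w = N.M.code t N.w := fun t =>
    KripkeModel.code_unravel t N.w (.nil N.w)
  constructor
  · intro hN
    obtain ⟨t, ht⟩ := h.exists_forall_code_eq hN
    exact ht N (hcode t).symm
  · intro hN
    obtain ⟨t, ht⟩ := h.exists_forall_code_eq hN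
    exact ht _ (hcode t)

/-- Soundness: a node's own type is always among its possible types. Completeness: at the depth
where the GNN decides, every model with the same code lies in `P`, so every possible type is the
type of a tree in `P`, and by the choice of `k` all trees of that type are in `P`. -/
theorem GNNExpressible.gmscDefinable {P : NodeProperty.{u, v} Sig} (h : GNNExpressible P)
    (hP : MSODefinable P) : GMSCDefinable P := by
  obtain ⟨k, hk⟩ := hP.exists_treeType_determines
  obtain ⟨L, hL⟩ := exists_program_possibleTypes_subset.{u, v} k
    {τ | ∀ N : PointedModel.{u, v} Sig, N.M.treeType k N.w = τ → N.unravel ∈ P}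
  refine ⟨L, fun N => (hL N).trans ⟨?_, fun hN => ?_⟩⟩
  · rintro ⟨t, ht⟩
    exact (h.unravel_mem_iff N).1 (ht ⟨N, rfl, rfl⟩ N rfl)
  · obtain ⟨t, ht⟩ := h.exists_forall_code_eq hN
    refine ⟨t, ?_⟩
    rintro _ ⟨N', hcode, rfl⟩ N'' hN''
    exact (hk _ _ hN'').2 ((h.unravel_mem_iff N').2 (ht N' hcode))

end Main

theorem theorem4p1 {Sig : Type v} [Finite Sig] (P : NodeProperty.{u, v} Sig)
    (hP : MSODefinable P) : GNNExpressible P ↔ GMSCDefinable P :=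
  ⟨fun h => h.gmscDefinable hP, fun h => h.gnnExpressible⟩
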